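/- **Setting.** Let $\mathbb F$ be $\mathbb R$ or $\mathbb C$, let $T>0$ and let $g:\mathbb R\to\mathbb R$ be nondecreasing and left-continuous. Put $\Delta g(t)=g(t^+)-g(t)$, $D_g=\{t:\Delta g(t)>0\}$, $C_g=\{t: g \text{ is constant on some } (t-\varepsilon,t+\varepsilon)\}$; let $N_g^-$ (resp. $N_g^+$) be the set of left (resp. right) endpoints of the connected components of $C_g$ that are not in $D_g$, and $N_g=N_g^-\cup N_g^+$. Assume $0\notin N_g^-$ and $T\notin N_g^+\cup D_g\cup C_g$. Let $\mu_g$ be the Lebesgue–Stieltjes measure with $\mu_g([c,d))=g(d)-g(c)$. For $t\in[0,T]$ put $t^*=t$ if $t\notin C_g$, and let $t^*$ be the right endpoint of the component of $C_g$ containing $t$ if $t\in C_g$. For $f:[0,T]\to\mathbb F$ the $g$-derivative is $$f'_g(t)=\lim_{s\to t}\frac{f(s)-f(t)}{g(s)-g(t)}\ \ (t\notin D_g\cup C_g),\qquad f'_g(t)=\lim_{s\to t^{*+}}\frac{f(s)-f(t^*)}{g(s)-g(t^*)}\ \ (t\in D_g\cup C_g),$$ where $s$ runs over the points of $[0,T]$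 at which the quotient is defined. The function $f$ is $g$-continuous at $t$ if for every $\varepsilon>0$ there is $\delta>0$ with $|f(t)-f(s)|<\varepsilon$ for all $s\in[0,T]$ with $|g(t)-g(s)|<\delta$; it is left (right) $g$-continuous at $t$ if this holds for the $s<t$ ($s>t$). Let $\mathcal{BD}_g$ be the space of bounded $f:[0,T]\to\mathbb F$ that are $g$-continuous on $[0,T]\setminus(C_g\cup N_g\cup D_g)$, left $g$-continuous on $N_g^-$ and right $g$-continuous on $N_g^+$, and let $\mathcal{BD}^1_g$ be the space of $f\in\mathcal{BD}_g$ for which $f'_g(t)$ exists for every $t\in[0,T]$ and $f'_g\in\mathcal{BD}_g$. Let $\ker\partial_g$ be the kernel of $\partial_g:\mathcal{BD}^1_g\to\mathcal{BD}_g$, $\partial_gf=f'_g$. Let $W^{1,1}_g$ be the set of $\mu_g$-integrable $u:[0,T]\to\mathbb F$ for which there is a $\mu_g$-integrable $\widetilde u$ with $u(y)-u(x)=\int_{[x,y)}\widetilde u\,d\mu_g$ for all $x\le y$ in $[0,T]$. **Proposition.** Let $\beta\in\mathcal{BD}_g$ be $g$-regressive, that is, $1+\beta(t)\Delta g(t)\ne0$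 for $t\in[0,T]\cap D_g$. Consider $$(\mathrm P)\qquad w'_g(t)-\beta(t)w(t)=0\ \text{ for } g\text{-a.e. } t\in[0,T),\qquad w(0)=1.$$ 1. Problem (P) has exactly one solution $v$ in $W^{1,1}_g$, and $v\in\mathcal{BD}^1_g$. 2. Let $h\in\mathcal{BD}^1_g$ with $h(0)=1$. Then $h\in\ker\partial_g$ if and only if $hv\in\mathcal{BD}^1_g$, $hv$ solves (P), and $(hv)'_g(t)-\beta(t)\,h(t)v(t)=0$ for every $t\in[0,T]\setminus C_g$. 3. The vector space of all $w\in\mathcal{BD}^1_g$ that satisfy $w'_g-\beta w=0$ $g$-a.e. on $[0,T)$ has the same dimension as $\ker\partial_g$, and it is the linear span of the set $S$ of the solutions of (P) in $\mathcal{BD}^1_g$. The linear span of the differences of elements of $S$ has dimension $d$ with $d+1=\dim\ker\partial_g$. (Dimensions are cardinal numbers.) -/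

import Mathlib

open Set Filter Topology MeasureTheory

noncomputable section

/-- A derivator: a left-continuous nondecreasing function `g : ℝ → ℝ`. -/
structure Derivator where
  toFun : ℝ → ℝ
  mono : Monotone toFun
  leftCont : ∀ t, ContinuousWithinAt toFun (Iic t) t

namespace Derivator

instance : CoeFun Derivator (fun _ => ℝ → ℝ) := ⟨Derivator.toFun⟩

variable (g : Derivator)

/-- The jump `Δg(t) = g(t⁺) - g(t)`. -/
def jump (t : ℝ) : ℝ := Function.rightLim g t - g t

/-- `D_g`: the set of discontinuity points of `g`. -/
def D : Set ℝ := {t | 0 < g.jump t}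

/-- `C_g`: the points around which `g` is constant. -/
def C : Set ℝ := {t | ∃ ε > 0, ∀ s ∈ Ioo (t - ε) (t + ε), g s = g t}

/-- `N_g⁻`: the left endpoints of the connected components of the open set `C_g`
(that is, the points outside `C_g` with a right neighbourhood inside `C_g`) not lying in `D_g`. -/
def Nminus : Set ℝ := {t | t ∉ g.C ∧ ∃ d, t < d ∧ Ioo t d ⊆ g.C} \ g.D

/-- `N_g⁺`: the right endpoints of the connected components of `C_g` not lying in `D_g`. -/
def Nplus : Set ℝ := {t | t ∉ g.C ∧ ∃ d, d < t ∧ Ioo d t ⊆ g.C} \ g.D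

/-- `N_g = N_g⁻ ∪ N_g⁺`. -/
def N : Set ℝ := g.Nminus ∪ g.Nplus

/-- `c = t^*`: if `t ∉ C_g` then `c = t`, and if `t ∈ C_g` then `c` is the right endpoint of the
connected component of `C_g` that contains `t`. -/
def IsStar (t c : ℝ) : Prop :=
  (t ∉ g.C ∧ c = t) ∨ (t ∈ g.C ∧ t < c ∧ c ∉ g.C ∧ Ico t c ⊆ g.C)

lemma IsStar.unique {g : Derivator} {t c c' : ℝ} (h : g.IsStar t c) (h' : g.IsStar t c') :
    c = c' := by
  rcases h with ⟨h1, h2⟩ | ⟨h1, h2, h3, h4⟩ <;> rcases h' with ⟨k1, k2⟩ | ⟨k1, k2, k3, k4⟩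
  · rw [h2, k2]
  · exact absurd k1 h1
  · exact absurd h1 k1
  · rcases lt_trichotomy c c' with h | h | h
    · exact absurd (k4 ⟨h2.le, h⟩) h3
    · exact h
    · exact absurd (h4 ⟨k2.le, h⟩) k3

/-- The Lebesgue–Stieltjes measure of `g`, normalised by `μ_g [c, d) = g d - g c`. -/
def measure : Measure ℝ := g.mono.stieltjesFunction.measure

lemma measure_Ico (c d : ℝ) : g.measure (Ico c d) = ENNReal.ofReal (g d - g c) := by
  have key : ∀ x, Function.leftLim g.mono.stieltjesFunction x = g x := by
    intro x
    have h1 : Function.leftLim g x = g x :=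
      g.mono.continuousWithinAt_Iio_iff_leftLim_eq.1 ((g.leftCont x).mono Iio_subset_Iic_self)
    apply le_antisymm
    · refine le_of_tendsto (g.mono.stieltjesFunction.mono.tendsto_leftLim x) ?_
      filter_upwards [self_mem_nhdsWithin] with y hy
      rw [Monotone.stieltjesFunction_eq]
      exact g.mono.rightLim_le hy
    · rw [← h1]
      refine le_of_tendsto_of_tendsto (g.mono.tendsto_leftLim x)
        (g.mono.stieltjesFunction.mono.tendsto_leftLim x) ?_
      filter_upwards with y
      rw [Monotone.stieltjesFunction_eq]
      exact g.mono.le_rightLim le_rfl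
  rw [measure, StieltjesFunction.measure_Ico, key, key]

/-- `μ_g` as a measure on the interval `[a, b]`. -/
def measureOn (a b : ℝ) : Measure (Icc a b) := g.measure.comap (fun s : Icc a b => (s : ℝ))

section Functions

variable {𝕜 : Type*} [RCLike 𝕜] {a b : ℝ}

/-- `f` is `g`-continuous at `t` along `S`. For `S = univ` this is `g`-continuity at `t`, for
`S = Iio t` left `g`-continuity and for `S = Ioi t` right `g`-continuity. -/
def GContWithin (f : Icc a b → 𝕜) (S : Set (Icc a b)) (t : Icc a b) : Prop :=
  ∀ ε > 0, ∃ δ > 0, ∀ s ∈ S, |g t - g s| < δ → ‖f t - f s‖ < ε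

/-- `f` is `g`-differentiable at `t ∈ [a, b]` with `g`-derivative `L`:
* if `t ∉ D_g ∪ C_g`, then `L` is the limit, as `s → t`, of the difference quotient
  (on its domain `g s ≠ g t`);
* if `t ∈ D_g ∪ C_g`, then `L` is the limit of the quotient based at `t^*` as `s → t^*` from
  the right. -/
def HasGDerivAt (f : Icc a b → 𝕜) (L : 𝕜) (t : Icc a b) : Prop :=
  ((t : ℝ) ∉ g.D ∪ g.C ∧
    Tendsto (fun s : Icc a b => (f s - f t) / ((g s - g t : ℝ) : 𝕜))
      (𝓝[{s : Icc a b | g s ≠ g t}] t) (𝓝 L)) ∨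
  ((t : ℝ) ∈ g.D ∪ g.C ∧ ∃ c : Icc a b, g.IsStar t c ∧
    Tendsto (fun s : Icc a b => (f s - f c) / ((g s - g c : ℝ) : 𝕜)) (𝓝[>] c) (𝓝 L))

variable {g}

lemma GContWithin.add {f₁ f₂ : Icc a b → 𝕜} {S : Set (Icc a b)} {t : Icc a b}
    (h₁ : g.GContWithin f₁ S t) (h₂ : g.GContWithin f₂ S t) :
    g.GContWithin (f₁ + f₂) S t := by
  intro ε hε
  obtain ⟨δ₁, hδ₁, H₁⟩ := h₁ (ε / 2) (half_pos hε)
  obtain ⟨δ₂, hδ₂, H₂⟩ := h₂ (ε / 2) (half_pos hε)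
  refine ⟨min δ₁ δ₂, lt_min hδ₁ hδ₂, fun s hs hst => ?_⟩
  have e : (f₁ + f₂) t - (f₁ + f₂) s = (f₁ t - f₁ s) + (f₂ t - f₂ s) := by
    simp only [Pi.add_apply]; ring
  rw [e]
  have i₁ := H₁ s hs (hst.trans_le (min_le_left _ _))
  have i₂ := H₂ s hs (hst.trans_le (min_le_right _ _))
  have i₃ := norm_add_le (f₁ t - f₁ s) (f₂ t - f₂ s)
  linarith

lemma GContWithin.zero {S : Set (Icc a b)} {t : Icc a b} :
    g.GContWithin (0 : Icc a b → 𝕜) S t := by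
  intro ε hε
  exact ⟨1, one_pos, fun s _ _ => by simpa using hε⟩

lemma GContWithin.smul (c : 𝕜) {f : Icc a b → 𝕜} {S : Set (Icc a b)} {t : Icc a b}
    (h : g.GContWithin f S t) : g.GContWithin (c • f) S t := by
  intro ε hε
  have hc : 0 < ‖c‖ + 1 := by positivity
  obtain ⟨δ, hδ, H⟩ := h (ε / (‖c‖ + 1)) (div_pos hε hc)
  refine ⟨δ, hδ, fun s hs hst => ?_⟩
  have e : (c • f) t - (c • f) s = c * (f t - f s) := by
    simp only [Pi.smul_apply, smul_eq_mul]; ring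
  have i := H s hs hst
  rw [lt_div_iff₀ hc] at i
  rw [e, norm_mul]
  nlinarith [norm_nonneg (f t - f s), norm_nonneg c]

lemma HasGDerivAt.add {f₁ f₂ : Icc a b → 𝕜} {L₁ L₂ : 𝕜} {t : Icc a b}
    (h₁ : g.HasGDerivAt f₁ L₁ t) (h₂ : g.HasGDerivAt f₂ L₂ t) :
    g.HasGDerivAt (f₁ + f₂) (L₁ + L₂) t := by
  rcases h₁ with ⟨m, h₁⟩ | ⟨m, c, hc, h₁⟩ <;> rcases h₂ with ⟨m', h₂⟩ | ⟨m', c', hc', h₂⟩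
  · refine Or.inl ⟨m, (h₁.add h₂).congr fun s => ?_⟩
    simp only [Pi.add_apply]; ring
  · exact absurd m' m
  · exact absurd m m'
  · obtain rfl : c = c' := Subtype.ext (hc.unique hc')
    refine Or.inr ⟨m, c, hc, (h₁.add h₂).congr fun s => ?_⟩
    simp only [Pi.add_apply]; ring

lemma HasGDerivAt.smul (k : 𝕜) {f : Icc a b → 𝕜} {L : 𝕜} {t : Icc a b}
    (h : g.HasGDerivAt f L t) : g.HasGDerivAt (k • f) (k * L) t := by
  rcases h with ⟨m, h⟩ | ⟨m, c, hc, h⟩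
  · refine Or.inl ⟨m, (h.const_mul k).congr fun s => ?_⟩
    simp only [Pi.smul_apply, smul_eq_mul]; ring
  · refine Or.inr ⟨m, c, hc, (h.const_mul k).congr fun s => ?_⟩
    simp only [Pi.smul_apply, smul_eq_mul]; ring

variable (g) in
/-- The standing assumptions on the interval `[a, b]`: it is nondegenerate, `a ∉ N_g⁻` and
`b ∉ N_g⁺ ∪ D_g ∪ C_g`. -/
structure Admissible (a b : ℝ) : Prop where
  lt : a < b
  left : a ∉ g.Nminus
  right : b ∉ g.Nplus ∪ g.D ∪ g.C

lemma Admissible.exists_isStar (H : g.Admissible a b) (t : Icc a b) :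
    ∃ c : Icc a b, g.IsStar t c := by
  have hb : b ∉ g.C := fun h => H.right (Or.inr h)
  by_cases ht : (t : ℝ) ∈ g.C
  · have hopen : IsOpen g.C := by
      rw [Metric.isOpen_iff]
      rintro x ⟨ε, hε, K⟩
      refine ⟨ε / 2, half_pos hε, fun y hy => ⟨ε / 2, half_pos hε, fun s hs => ?_⟩⟩
      rw [Real.ball_eq_Ioo] at hy
      rw [K s ⟨by linarith [hs.1, hy.1], by linarith [hs.2, hy.2]⟩,
        K y ⟨by linarith [hy.1], by linarith [hy.2]⟩]
    have hcl : IsClosed (Icc (t : ℝ) b ∩ (g.C)ᶜ) := isClosed_Icc.inter hopen.isClosed_compl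
    have hne : (Icc (t : ℝ) b ∩ (g.C)ᶜ).Nonempty := ⟨b, ⟨t.2.2, le_rfl⟩, hb⟩
    have hbd : BddBelow (Icc (t : ℝ) b ∩ (g.C)ᶜ) := ⟨t, fun x hx => hx.1.1⟩
    have hm := hcl.csInf_mem hne hbd
    generalize hc : sInf (Icc (t : ℝ) b ∩ (g.C)ᶜ) = c at hm
    refine ⟨⟨c, t.2.1.trans hm.1.1, hm.1.2⟩, Or.inr ⟨ht, ?_, hm.2, ?_⟩⟩
    · refine lt_of_le_of_ne hm.1.1 fun h => hm.2 ?_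
      have h' : (t : ℝ) = c := h
      rwa [← h']
    · intro x hx
      by_contra hxC
      have : c ≤ x := hc ▸ csInf_le hbd ⟨⟨hx.1, (hx.2.trans_le hm.1.2).le⟩, hxC⟩
      exact absurd this (not_le.2 hx.2)
  · exact ⟨t, Or.inl ⟨ht, rfl⟩⟩

lemma HasGDerivAt.zero (H : g.Admissible a b) (t : Icc a b) :
    g.HasGDerivAt (0 : Icc a b → 𝕜) 0 t := by
  by_cases m : (t : ℝ) ∈ g.D ∪ g.C
  · obtain ⟨c, hc⟩ := H.exists_isStar t
    exact Or.inr ⟨m, c, hc, tendsto_const_nhds.congr fun s => by simp⟩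
  · exact Or.inl ⟨m, tendsto_const_nhds.congr fun s => by simp⟩

lemma mem_C_of_const {u v t : ℝ} (ht : t ∈ Ioo u v) {k : ℝ} (h : ∀ s ∈ Ioo u v, g s = k) :
    t ∈ g.C := by
  refine ⟨min (t - u) (v - t), lt_min (by linarith [ht.1]) (by linarith [ht.2]), fun s hs => ?_⟩
  have h1 := min_le_left (t - u) (v - t)
  have h2 := min_le_right (t - u) (v - t)
  rw [h s ⟨by linarith [hs.1], by linarith [hs.2]⟩, h t ht]

lemma Admissible.neBot (H : g.Admissible a b) {t : Icc a b} (m : (t : ℝ) ∉ g.D ∪ g.C) :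
    (𝓝[{s : Icc a b | g s ≠ g t}] t).NeBot := by
  rw [← mem_closure_iff_nhdsWithin_neBot, Metric.mem_closure_iff]
  by_contra hcon
  push Not at hcon
  obtain ⟨ε, hε, K⟩ := hcon
  have hD : (t : ℝ) ∉ g.D := fun h => m (Or.inl h)
  have hC : (t : ℝ) ∉ g.C := fun h => m (Or.inr h)
  have K' : ∀ s ∈ Ioo ((t : ℝ) - ε) (t + ε), a ≤ s → s ≤ b → g s = g t := by
    intro s hs h1 h2
    by_contra hne
    have := K ⟨s, h1, h2⟩ hne
    rw [Subtype.dist_eq, Real.dist_eq] at this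
    have h3 : |(t : ℝ) - s| < ε := abs_lt.2 ⟨by linarith [hs.2], by linarith [hs.1]⟩
    exact absurd h3 (not_lt.2 this)
  have hl := t.2.1
  have hr := t.2.2
  rcases hl.eq_or_lt with ha | ha
  · apply H.left
    rw [ha]
    refine ⟨⟨hC, min (t + ε) b, lt_min (by linarith) (by linarith [H.lt]), ?_⟩, hD⟩
    intro x hx
    have h1 := min_le_left ((t : ℝ) + ε) b
    have h2 := min_le_right ((t : ℝ) + ε) b
    exact mem_C_of_const hx (k := g t) fun s hs =>
      K' s ⟨by linarith [hs.1], by linarith [hs.2]⟩ (by linarith [hs.1]) (by linarith [hs.2])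
  · rcases hr.eq_or_lt with hb | hb
    · apply H.right
      rw [← hb]
      refine Or.inl (Or.inl ⟨⟨hC, max (t - ε) a, max_lt (by linarith) ha, ?_⟩, hD⟩)
      intro x hx
      have h1 := le_max_left ((t : ℝ) - ε) a
      have h2 := le_max_right ((t : ℝ) - ε) a
      exact mem_C_of_const hx (k := g t) fun s hs =>
        K' s ⟨by linarith [hs.1], by linarith [hs.2]⟩ (by linarith [hs.1]) (by linarith [hs.2])
    · apply hC
      refine mem_C_of_const (u := max (t - ε) a) (v := min (t + ε) b)
        ⟨max_lt (by linarith) ha, lt_min (by linarith) hb⟩ (k := g t) fun s hs => ?_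
      have h1 := le_max_left ((t : ℝ) - ε) a
      have h2 := le_max_right ((t : ℝ) - ε) a
      have h3 := min_le_left ((t : ℝ) + ε) b
      have h4 := min_le_right ((t : ℝ) + ε) b
      exact K' s ⟨by linarith [hs.1], by linarith [hs.2]⟩ (by linarith [hs.1])
        (by linarith [hs.2])

lemma Admissible.neBot_right (H : g.Admissible a b) {t c : Icc a b}
    (m : (t : ℝ) ∈ g.D ∪ g.C) (hc : g.IsStar t c) : (𝓝[>] c).NeBot := by
  have hcb : (c : ℝ) ≠ b := by
    intro h
    rcases hc with ⟨h1, h2⟩ | ⟨h1, h2, h3, h4⟩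
    · rw [← h, h2] at H
      rcases m with m | m
      · exact H.right (Or.inl (Or.inr m))
      · exact h1 m
    · rw [← h] at H
      by_cases hD : (c : ℝ) ∈ g.D
      · exact H.right (Or.inl (Or.inr hD))
      · exact H.right (Or.inl (Or.inl ⟨⟨h3, t, h2, fun x hx => h4 ⟨hx.1.le, hx.2⟩⟩, hD⟩))
  exact nhdsGT_neBot_of_exists_gt
    ⟨(⟨b, H.lt.le, le_rfl⟩ : Icc a b), Subtype.coe_lt_coe.1 (lt_of_le_of_ne c.2.2 hcb)⟩

/-- The `g`-derivative is unique. -/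
lemma HasGDerivAt.unique (H : g.Admissible a b) {f : Icc a b → 𝕜} {L L' : 𝕜} {t : Icc a b}
    (h : g.HasGDerivAt f L t) (h' : g.HasGDerivAt f L' t) : L = L' := by
  rcases h with ⟨m, h⟩ | ⟨m, c, hc, h⟩ <;> rcases h' with ⟨m', h'⟩ | ⟨m', c', hc', h'⟩
  · have := H.neBot m
    exact tendsto_nhds_unique h h'
  · exact absurd m' m
  · exact absurd m m'
  · obtain rfl : c = c' := Subtype.ext (hc.unique hc')
    have := H.neBot_right m hc
    exact tendsto_nhds_unique h h'

variable (g 𝕜 a b) in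
/-- The space `BD_g([a, b]; 𝕜)`: bounded functions which are `g`-continuous on
`[a, b] \ (C_g ∪ N_g ∪ D_g)`, left `g`-continuous on `N_g⁻` and right `g`-continuous on `N_g⁺`. -/
def BD : Submodule 𝕜 (Icc a b → 𝕜) where
  carrier := {f | (∃ M : ℝ, ∀ t, ‖f t‖ ≤ M) ∧
    (∀ t : Icc a b, (t : ℝ) ∉ g.C ∪ g.N ∪ g.D → g.GContWithin f univ t) ∧
    (∀ t : Icc a b, (t : ℝ) ∈ g.Nminus → g.GContWithin f (Iio t) t) ∧
    (∀ t : Icc a b, (t : ℝ) ∈ g.Nplus → g.GContWithin f (Ioi t) t)}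
  add_mem' := by
    rintro f₁ f₂ ⟨⟨M₁, h₁⟩, i₁, j₁, k₁⟩ ⟨⟨M₂, h₂⟩, i₂, j₂, k₂⟩
    exact ⟨⟨M₁ + M₂, fun t => (norm_add_le _ _).trans (add_le_add (h₁ t) (h₂ t))⟩,
      fun t ht => (i₁ t ht).add (i₂ t ht), fun t ht => (j₁ t ht).add (j₂ t ht),
      fun t ht => (k₁ t ht).add (k₂ t ht)⟩
  zero_mem' := ⟨⟨0, fun t => by simp⟩, fun t _ => GContWithin.zero,
    fun t _ => GContWithin.zero, fun t _ => GContWithin.zero⟩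
  smul_mem' := by
    rintro c f ⟨⟨M, h⟩, i, j, k⟩
    refine ⟨⟨‖c‖ * M, fun t => ?_⟩, fun t ht => (i t ht).smul c, fun t ht => (j t ht).smul c,
      fun t ht => (k t ht).smul c⟩
    rw [Pi.smul_apply, norm_smul]
    exact mul_le_mul_of_nonneg_left (h t) (norm_nonneg c)

variable (𝕜) in
/-- The space `BD¹_g([a, b]; 𝕜)`: functions in `BD_g` which are `g`-differentiable at every point
of `[a, b]`, with `g`-derivative in `BD_g`. -/
def BD1 (H : g.Admissible a b) : Submodule 𝕜 (Icc a b → 𝕜) where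
  carrier := {f | f ∈ g.BD 𝕜 a b ∧ ∃ f' ∈ g.BD 𝕜 a b, ∀ t, g.HasGDerivAt f (f' t) t}
  add_mem' := by
    rintro f₁ f₂ ⟨h₁, d₁, i₁, j₁⟩ ⟨h₂, d₂, i₂, j₂⟩
    exact ⟨add_mem h₁ h₂, d₁ + d₂, add_mem i₁ i₂, fun t => (j₁ t).add (j₂ t)⟩
  zero_mem' := ⟨zero_mem _, 0, zero_mem _, fun t => HasGDerivAt.zero H t⟩
  smul_mem' := by
    rintro c f ⟨h, d, i, j⟩
    exact ⟨Submodule.smul_mem _ c h, c • d, Submodule.smul_mem _ c i, fun t => (j t).smul c⟩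

variable (𝕜) in
/-- The operator `∂_g : BD¹_g → BD_g` that sends `f` to its `g`-derivative. -/
def gDeriv (H : g.Admissible a b) : BD1 𝕜 H →ₗ[𝕜] g.BD 𝕜 a b where
  toFun f := ⟨f.2.2.choose, f.2.2.choose_spec.1⟩
  map_add' f₁ f₂ := Subtype.ext <| funext fun t =>
    ((f₁ + f₂).2.2.choose_spec.2 t).unique H
      ((f₁.2.2.choose_spec.2 t).add (f₂.2.2.choose_spec.2 t))
  map_smul' c f := Subtype.ext <| funext fun t =>
    ((c • f).2.2.choose_spec.2 t).unique H ((f.2.2.choose_spec.2 t).smul c)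

lemma hasGDerivAt_gDeriv (H : g.Admissible a b) (f : BD1 𝕜 H) (t : Icc a b) :
    g.HasGDerivAt (f : Icc a b → 𝕜) ((gDeriv 𝕜 H f : Icc a b → 𝕜) t) t :=
  f.2.2.choose_spec.2 t

variable (g) in
/-- `β` is `g`-regressive: `1 + β(t) Δg(t) ≠ 0` for `t ∈ [a, b] ∩ D_g`. -/
def IsRegressive (β : Icc a b → 𝕜) : Prop :=
  ∀ t : Icc a b, (t : ℝ) ∈ g.D → 1 + β t * (g.jump t : 𝕜) ≠ 0

variable (g) in
/-- The Stieltjes–Sobolev space `W^{1,1}_g([a, b]; 𝕜)`: `μ_g`-integrable functions `u` for which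
there is a `μ_g`-integrable `u'` with `u y - u x = ∫_{[x, y)} u' dμ_g` for `x ≤ y` in `[a, b]`. -/
def MemW11 (u : Icc a b → 𝕜) : Prop :=
  IntegrableOn u {s | (s : ℝ) < b} (g.measureOn a b) ∧
  ∃ u' : Icc a b → 𝕜, IntegrableOn u' {s | (s : ℝ) < b} (g.measureOn a b) ∧
    ∀ x y : Icc a b, x ≤ y → u y - u x = ∫ s in Ico x y, u' s ∂(g.measureOn a b)

variable (g) in
/-- `w` satisfies `w'_g(t) - β(t) w(t) = 0` for `g`-almost every `t ∈ [a, b)`. -/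
def SolvesAE (β w : Icc a b → 𝕜) : Prop :=
  ∀ᵐ t : Icc a b ∂(g.measureOn a b), (t : ℝ) < b → g.HasGDerivAt w (β t * w t) t

/-- The left endpoint of `[a, b]`, as an element of `[a, b]`. -/
def Admissible.start (H : g.Admissible a b) : Icc a b := ⟨a, le_rfl, H.lt.le⟩

/-- `v` is a `W^{1,1}_g`-solution of the problem `v'_g - β v = 0` `g`-a.e. on `[a, b)`,
`v(a) = 1`. -/
def IsW11Solution (H : g.Admissible a b) (β v : Icc a b → 𝕜) : Prop :=
  g.MemW11 v ∧ g.SolvesAE β v ∧ v H.start = 1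

/-- `w` is a `BD¹_g`-solution of the problem `w'_g - β w = 0` `g`-a.e. on `[a, b)`,
`w(a) = 1`. -/
def IsBDSolution (H : g.Admissible a b) (β w : Icc a b → 𝕜) : Prop :=
  w ∈ BD1 𝕜 H ∧ g.SolvesAE β w ∧ w H.start = 1

/-- The space of the solutions `w ∈ BD¹_g` of the homogeneous linear equation
`w'_g - β w = 0` `g`-a.e. on `[a, b)`. -/
def solutionSpace (H : g.Admissible a b) (β : Icc a b → 𝕜) : Submodule 𝕜 (Icc a b → 𝕜) where
  carrier := {w | w ∈ BD1 𝕜 H ∧ g.SolvesAE β w}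
  add_mem' := by
    rintro w₁ w₂ ⟨h₁, e₁⟩ ⟨h₂, e₂⟩
    refine ⟨add_mem h₁ h₂, ?_⟩
    filter_upwards [e₁, e₂] with t i₁ i₂ ht
    have := (i₁ ht).add (i₂ ht)
    rwa [← mul_add] at this
  zero_mem' := by
    refine ⟨zero_mem _, Eventually.of_forall fun t _ => ?_⟩
    simpa using HasGDerivAt.zero (𝕜 := 𝕜) H t
  smul_mem' := by
    rintro c w ⟨h, e⟩
    refine ⟨Submodule.smul_mem _ c h, ?_⟩
    filter_upwards [e] with t i ht
    have := (i ht).smul c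
    rwa [mul_left_comm] at this

end Functions

end Derivator

end

/-! Everything is transported to Lebesgue measure by the generalized inverse Q of g. The image of
Lebesgue measure on [g(0), g(T)) under Q is `μ_g` on [0, T), so an integral over [x, y) against
`μ_g` becomes the integral of f ∘ Q from g(x) to g(y) (`map_quantile_volume`, `setIntegral_Ico_eq`).
The integral form of (P) turns into a Volterra equation with delay, W(r) = 1 + ∫ β(Q(s)) W(g(Q(s)))
ds, and g(Q(s)) ≤ s, so some Picard iterate is a contraction. Its unique solution gives v = W ∘ g.

Lebesgue differentiation on the r-axis identifies the solutions in `W^{1,1}_g` with those of the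
integral equation (`isW11Solution_iff`). For integrands in `BD_g` the integral has the expected
derivative at every point off `C_g` (`hasGDerivAt_of_mem_BD`), and functions in `BD_g` that agree
almost everywhere agree off `C_g` (`eq_of_ae_eq`). Hence v is in `BD¹_g`, and every `BD¹_g` solution
satisfies the equation at each point off `C_g`.

Regressivity keeps v away from zero (`ne_zero`, `exists_norm_inv_le`). The product and quotient
rules then make multiplication by v an isomorphism from `ker ∂_g` onto the space of solutions
(`kerEquiv`), which gives part 2 and the equality of dimensions. The rest of part 3 is linear
algebra: S is the affine hyperplane w(0) = 1 of the solution space. -/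

noncomputable section

namespace Derivator

variable {g : Derivator} {a b : ℝ} {𝕜 : Type*} [RCLike 𝕜]

/-! ### Jumps and flat pieces of g, and the point t^*. -/

lemma tendsto_nhdsLE (t : ℝ) : Tendsto g (𝓝[≤] t) (𝓝 (g t)) := g.leftCont t

lemma tendsto_nhdsGT (t : ℝ) : Tendsto g (𝓝[>] t) (𝓝 (g t + g.jump t)) := by
  have := g.mono.tendsto_rightLim t
  simpa [jump] using this

lemma jump_nonneg (t : ℝ) : 0 ≤ g.jump t := sub_nonneg.2 (g.mono.le_rightLim le_rfl)

lemma add_jump_le {s t : ℝ} (h : t < s) : g t + g.jump t ≤ g s := by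
  have := g.mono.rightLim_le h
  simpa [jump] using this

lemma jump_eq_zero {t : ℝ} (h : t ∉ g.D) : g.jump t = 0 :=
  le_antisymm (not_lt.1 h) (jump_nonneg t)

lemma continuousAt_of_notMem_D {t : ℝ} (h : t ∉ g.D) : ContinuousAt g t := by
  rw [continuousAt_iff_continuous_left'_right']
  refine ⟨(g.leftCont t).mono Iio_subset_Iic_self, ?_⟩
  have := tendsto_nhdsGT (g := g) t
  rwa [jump_eq_zero h, add_zero] at this

lemma countable_D : (g.D).Countable := by
  refine g.mono.countable_not_continuousAt.mono ?_
  rintro t ht hc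
  have h1 := tendsto_nhds_unique (tendsto_nhdsGT (g := g) t) (hc.mono_left nhdsWithin_le_nhds)
  have h2 : 0 < g.jump t := ht
  linarith

lemma eventuallyEq_of_mem_C {t : ℝ} (h : t ∈ g.C) : ∀ᶠ s in 𝓝 t, g s = g t := by
  obtain ⟨ε, hε, K⟩ := h
  exact mem_of_superset (Ioo_mem_nhds (by linarith) (by linarith)) K

lemma isOpen_C : IsOpen g.C := by
  rw [isOpen_iff_mem_nhds]
  rintro x ⟨ε, hε, K⟩
  refine mem_of_superset (Ioo_mem_nhds (a := x - ε) (b := x + ε) (by linarith) (by linarith)) ?_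
  exact fun y hy => mem_C_of_const hy K

lemma notMem_D_of_mem_C {t : ℝ} (h : t ∈ g.C) : t ∉ g.D := by
  intro hD
  have h1 : Tendsto g (𝓝[>] t) (𝓝 (g t)) :=
    tendsto_const_nhds.congr'
      ((eventuallyEq_of_mem_C h).filter_mono nhdsWithin_le_nhds |>.mono fun s hs => hs.symm)
  have h2 := tendsto_nhds_unique (tendsto_nhdsGT (g := g) t) h1
  have h3 : 0 < g.jump t := hD
  linarith

/-- The derivative of g vanishes on [x, y), and left-continuity carries the constancy to y even if g
jumps there. -/
lemma eq_of_Ico_subset_C {x y : ℝ} (h : Ico x y ⊆ g.C) : ∀ z ∈ Icc x y, g z = g x := by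
  have hd : ∀ z ∈ Ico x y, HasDerivAt g 0 z := fun z hz =>
    (hasDerivAt_const z (g z)).congr_of_eventuallyEq (eventuallyEq_of_mem_C (h hz))
  refine constant_of_has_deriv_right_zero (fun z hz => ?_) fun z hz => (hd z hz).hasDerivWithinAt
  rcases hz.2.eq_or_lt with rfl | hzy
  · exact (g.leftCont z).mono Icc_subset_Iic_self
  · exact (hd z ⟨hz.1, hzy⟩).continuousAt.continuousWithinAt

lemma exists_eq_right_of_mem_Nminus {t : ℝ} (h : t ∈ g.Nminus) :
    ∃ d, t < d ∧ ∀ z ∈ Ioo t d, g z = g t := by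
  obtain ⟨⟨-, d, htd, hd⟩, hD⟩ := h
  refine ⟨d, htd, fun z hz => ?_⟩
  have h1 : Tendsto g (𝓝[>] t) (𝓝 (g t)) :=
    (continuousAt_of_notMem_D hD).mono_left nhdsWithin_le_nhds
  refine tendsto_nhds_unique (tendsto_const_nhds.congr' ?_) h1
  filter_upwards [Ioo_mem_nhdsGT hz.1] with x hx
  exact eq_of_Ico_subset_C (x := x) (y := z)
    (fun w hw => hd ⟨hx.1.trans_le hw.1, hw.2.trans hz.2⟩) z ⟨hx.2.le, le_rfl⟩

lemma exists_eq_left_of_mem_Nplus {t : ℝ} (h : t ∈ g.Nplus) :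
    ∃ d, d < t ∧ ∀ z ∈ Ioo d t, g z = g t := by
  obtain ⟨⟨-, d, htd, hd⟩, -⟩ := h
  exact ⟨d, htd, fun z hz => (eq_of_Ico_subset_C (x := z) (y := t)
    (fun w hw => hd ⟨hz.1.trans_le hw.1, hw.2⟩) t ⟨hz.2.le, le_rfl⟩).symm⟩

/-- A point of `N_g` is isolated from one side in the complement of `C_g`, and a set of reals has
only countably many such points. -/
lemma countable_N : (g.N).Countable := by
  refine ((countable_setOfPred_isolated_right_within (s := (g.C)ᶜ)).union
    (countable_setOfPred_isolated_left_within (s := (g.C)ᶜ))).mono ?_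
  rintro t (⟨⟨h1, d, h2, h3⟩, -⟩ | ⟨⟨h1, d, h2, h3⟩, -⟩)
  · refine Or.inl ⟨h1, empty_mem_iff_bot.1 ?_⟩
    filter_upwards [self_mem_nhdsWithin, mem_nhdsWithin_of_mem_nhds (Iio_mem_nhds h2)] with x hx hd
    exact hx.1 (h3 ⟨hx.2, hd⟩)
  · refine Or.inr ⟨h1, empty_mem_iff_bot.1 ?_⟩
    filter_upwards [self_mem_nhdsWithin, mem_nhdsWithin_of_mem_nhds (Ioi_mem_nhds h2)] with x hx hd
    exact hx.1 (h3 ⟨hd, hx.2⟩)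

lemma IsStar.le {t c : ℝ} (h : g.IsStar t c) : t ≤ c := by
  rcases h with ⟨-, rfl⟩ | ⟨-, h, -⟩
  exacts [le_rfl, h.le]

lemma IsStar.notMem_C {t c : ℝ} (h : g.IsStar t c) : c ∉ g.C := by
  rcases h with ⟨h, rfl⟩ | ⟨-, -, h, -⟩ <;> exact h

lemma IsStar.map_eq {t c : ℝ} (h : g.IsStar t c) : g c = g t := by
  rcases h with ⟨h, rfl⟩ | ⟨-, h1, -, h2⟩
  exacts [rfl, eq_of_Ico_subset_C h2 c ⟨h1.le, le_rfl⟩]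

lemma IsStar.le_of_le {t c x : ℝ} (h : g.IsStar t c) (hx : x ∉ g.C) (htx : t ≤ x) : c ≤ x := by
  rcases h with ⟨h, rfl⟩ | ⟨-, h1, -, h2⟩
  · exact htx
  · exact le_of_not_gt fun hc => hx (h2 ⟨htx, hc⟩)

lemma IsStar.mem_Nplus {t c : ℝ} (h : g.IsStar t c) (ht : t ∈ g.C) (hD : c ∉ g.D) :
    c ∈ g.Nplus := by
  rcases h with ⟨h, rfl⟩ | ⟨-, h1, h2, h3⟩
  · exact absurd ht h
  · exact ⟨⟨h2, t, h1, fun x hx => h3 ⟨hx.1.le, hx.2⟩⟩, hD⟩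

/-- If g(t) = g(s), then g would be constant on both sides of t and t would lie in `C_g`. -/
lemma lt_of_mem_Nplus {t s : ℝ} (h : t ∈ g.Nplus) (hs : t < s) : g t < g s := by
  refine lt_of_le_of_ne (g.mono hs.le) fun he => ?_
  obtain ⟨d, hd, K⟩ := exists_eq_left_of_mem_Nplus h
  refine h.1.1 (mem_C_of_const (u := d) (v := s) ⟨hd, hs⟩ (k := g t) fun z hz => ?_)
  rcases lt_or_ge z t with hzt | hzt
  · exact K z ⟨hz.1, hzt⟩
  · exact le_antisymm (he ▸ g.mono hz.2.le) (g.mono hzt)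

/-! ### Difference quotients at points off `C_g`. -/

variable (g) in
/-- The filter along which difference quotients at a point `t ∉ C_g` are evaluated. -/
def derivFilter (t : Icc a b) : Filter (Icc a b) :=
  open Classical in if (t : ℝ) ∈ g.D then 𝓝[>] t else 𝓝[{s : Icc a b | g s ≠ g t}] t

lemma hasGDerivAt_iff {f : Icc a b → 𝕜} {L : 𝕜} {t : Icc a b} (ht : (t : ℝ) ∉ g.C) :
    g.HasGDerivAt f L t ↔ Tendsto (fun s : Icc a b => (f s - f t) / ((g s - g t : ℝ) : 𝕜))
      (g.derivFilter t) (𝓝 L) := by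
  unfold HasGDerivAt derivFilter
  by_cases hD : (t : ℝ) ∈ g.D
  · simp only [hD, if_true]
    constructor
    · rintro (⟨h, -⟩ | ⟨-, c, hc, h⟩)
      · exact absurd (Or.inl hD) h
      · obtain rfl : c = t := Subtype.ext (hc.unique (Or.inl ⟨ht, rfl⟩))
        exact h
    · exact fun h => Or.inr ⟨Or.inl hD, t, Or.inl ⟨ht, rfl⟩, h⟩
  · have h1 : (t : ℝ) ∉ g.D ∪ g.C := fun h => h.elim hD ht
    simp [hD, h1]

lemma eventually_ne_derivFilter (t : Icc a b) : ∀ᶠ s : Icc a b in g.derivFilter t, g s ≠ g t := by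
  unfold derivFilter
  split_ifs with h
  · filter_upwards [self_mem_nhdsWithin] with s hs
    have h1 := add_jump_le (g := g) (Subtype.coe_lt_coe.2 hs)
    have h2 : 0 < g.jump t := h
    linarith
  · exact self_mem_nhdsWithin

lemma tendsto_coe_nhdsGT (t : Icc a b) :
    Tendsto (fun s : Icc a b => (s : ℝ)) (𝓝[>] t) (𝓝[>] (t : ℝ)) :=
  tendsto_nhdsWithin_of_tendsto_nhds_of_eventually_within _
    (continuous_subtype_val.continuousAt.mono_left nhdsWithin_le_nhds)
    (eventually_nhdsWithin_of_forall fun _ hs => hs)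

lemma tendsto_coe_nhdsLE (t : Icc a b) :
    Tendsto (fun s : Icc a b => (s : ℝ)) (𝓝[≤] t) (𝓝[≤] (t : ℝ)) :=
  tendsto_nhdsWithin_of_tendsto_nhds_of_eventually_within _
    (continuous_subtype_val.continuousAt.mono_left nhdsWithin_le_nhds)
    (eventually_nhdsWithin_of_forall fun _ hs => hs)

lemma tendsto_derivFilter (t : Icc a b) :
    Tendsto (fun s : Icc a b => g s) (g.derivFilter t) (𝓝 (g t + g.jump t)) := by
  unfold derivFilter
  split_ifs with h
  · exact (tendsto_nhdsGT _).comp (tendsto_coe_nhdsGT t)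
  · rw [jump_eq_zero h, add_zero]
    exact ((continuousAt_of_notMem_D h).tendsto.comp
      continuous_subtype_val.continuousAt).mono_left nhdsWithin_le_nhds

lemma tendsto_sub_derivFilter (t : Icc a b) :
    Tendsto (fun s : Icc a b => ((g s - g t : ℝ) : 𝕜)) (g.derivFilter t) (𝓝 (g.jump t : 𝕜)) := by
  have := (tendsto_derivFilter (g := g) t).sub_const (g t)
  rw [add_sub_cancel_left] at this
  exact (RCLike.continuous_ofReal.tendsto _).comp this

/-- The limit of a `g`-differentiable function along the filter of the difference quotients. -/
lemma HasGDerivAt.tendsto {f : Icc a b → 𝕜} {L : 𝕜} {t : Icc a b} (ht : (t : ℝ) ∉ g.C)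
    (h : g.HasGDerivAt f L t) :
    Tendsto f (g.derivFilter t) (𝓝 (f t + L * g.jump t)) := by
  have h1 := ((hasGDerivAt_iff ht).1 h).mul (tendsto_sub_derivFilter (𝕜 := 𝕜) t)
  refine (h1.const_add (f t)).congr' ?_
  filter_upwards [eventually_ne_derivFilter t] with s hs
  have : ((g s - g t : ℝ) : 𝕜) ≠ 0 := by exact_mod_cast sub_ne_zero.2 hs
  rw [div_mul_cancel₀ _ this]
  ring

/-- The usual product rule has an extra term h'v'Δg at jumps. Here h' = 0, so h tends to h(t) along
the filter even at a jump and the term is absent. -/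
lemma HasGDerivAt.mul_of_zero {h v : Icc a b → 𝕜} {L : 𝕜} {t : Icc a b} (ht : (t : ℝ) ∉ g.C)
    (hh : g.HasGDerivAt h 0 t) (hv : g.HasGDerivAt v L t) :
    g.HasGDerivAt (h * v) (h t * L) t := by
  have h1 := hh.tendsto ht
  rw [zero_mul, add_zero] at h1
  have hq := (hasGDerivAt_iff ht).1 hh
  rw [hasGDerivAt_iff ht] at hv ⊢
  have := (h1.mul hv).add (hq.mul_const (v t))
  rw [zero_mul, add_zero] at this
  refine this.congr fun s => ?_
  simp only [Pi.mul_apply]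
  ring

/-- In the quotient rule the numerator kwv - wkv cancels. The denominator tends to v(t)²(1 +
kΔg(t)), which is where regressivity enters. -/
lemma HasGDerivAt.div_of_proportional {w v : Icc a b → 𝕜} {k : 𝕜} {t : Icc a b}
    (ht : (t : ℝ) ∉ g.C) (hw : g.HasGDerivAt w (k * w t) t) (hv : g.HasGDerivAt v (k * v t) t)
    (hvt : v t ≠ 0) (hk : 1 + k * (g.jump t : 𝕜) ≠ 0) : g.HasGDerivAt (w / v) 0 t := by
  have h1 := hv.tendsto ht
  have h2 : v t + k * v t * (g.jump t : 𝕜) ≠ 0 := by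
    have e : v t + k * v t * (g.jump t : 𝕜) = v t * (1 + k * (g.jump t : 𝕜)) := by ring
    rw [e]
    exact mul_ne_zero hvt hk
  rw [hasGDerivAt_iff ht] at hv hw ⊢
  have := ((hw.mul_const (v t)).sub (hv.const_mul (w t))).div (h1.mul_const (v t))
    (mul_ne_zero h2 hvt)
  have e : (k * w t * v t - w t * (k * v t)) = 0 := by ring
  rw [e, zero_div] at this
  refine this.congr' ?_
  filter_upwards [h1.eventually_ne h2, eventually_ne_derivFilter t] with s hs hs'
  have : ((g s - g t : ℝ) : 𝕜) ≠ 0 := by exact_mod_cast sub_ne_zero.2 hs'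
  simp only [Pi.div_apply]
  field_simp
  ring

/-- For t in `C_g` the derivative is a right limit at t^*. If t^* is not a jump, g is flat just to
its left, so the two-sided quotient at t^* is defined only on the right and the two notions
coincide. -/
lemma hasGDerivAt_iff_star {f : Icc a b → 𝕜} {L : 𝕜} {t c : Icc a b}
    (hc : g.IsStar t c) : g.HasGDerivAt f L t ↔ g.HasGDerivAt f L c := by
  by_cases ht : (t : ℝ) ∈ g.C
  swap
  · rcases hc with ⟨-, h⟩ | ⟨h, -⟩
    · rw [Subtype.ext h]
    · exact absurd h ht
  have e : g.derivFilter c = 𝓝[>] c := by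
    unfold derivFilter
    split_ifs with hD
    · rfl
    have hN := hc.mem_Nplus ht hD
    have htc : t < c := lt_of_le_of_ne hc.le fun h => hc.notMem_C (h ▸ ht)
    refine nhdsWithin_eq_nhdsWithin (s := Ioi t) htc isOpen_Ioi ?_
    ext s
    refine ⟨fun ⟨h1, h2⟩ => ⟨not_le.1 fun h3 : s ≤ c => h1 ?_, h2⟩,
      fun ⟨h1, h2⟩ => ⟨(lt_of_mem_Nplus hN h1).ne', h2⟩⟩
    exact le_antisymm (g.mono h3) (hc.map_eq.le.trans (g.mono (le_of_lt h2)))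
  rw [hasGDerivAt_iff hc.notMem_C, e]
  constructor
  · rintro (⟨h, -⟩ | ⟨-, c', hc', h⟩)
    · exact absurd (Or.inr ht) h
    · obtain rfl : c' = c := Subtype.ext (hc'.unique hc)
      exact h
  · exact fun h => Or.inr ⟨Or.inr ht, c, hc, h⟩

/-! ### `g`-continuity and the spaces `BD_g` and `BD¹_g`. -/

/-- As convergence along a filter, `g`-continuity inherits the algebra of limits. -/
lemma gContWithin_iff_tendsto {f : Icc a b → 𝕜} {S : Set (Icc a b)} {t : Icc a b} :
    g.GContWithin f S t ↔
      Tendsto f (comap (fun s : Icc a b => g s) (𝓝 (g t)) ⊓ 𝓟 S) (𝓝 (f t)) := by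
  rw [(((Metric.nhds_basis_ball (x := g t)).comap (fun s : Icc a b => g s)).inf_principal
    S).tendsto_iff Metric.nhds_basis_ball]
  refine forall₂_congr fun ε _ => exists_congr fun δ => and_congr_right fun _ => ?_
  constructor
  · rintro h s ⟨h1, h2⟩
    rw [mem_preimage, Metric.mem_ball, dist_comm, Real.dist_eq] at h1
    rw [Metric.mem_ball, dist_comm, dist_eq_norm]
    exact h s h2 h1
  · intro h s h1 h2
    have := h s ⟨by rwa [mem_preimage, Metric.mem_ball, dist_comm, Real.dist_eq], h1⟩
    rwa [Metric.mem_ball, dist_comm, dist_eq_norm] at this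

lemma GContWithin.mul {f₁ f₂ : Icc a b → 𝕜} {S : Set (Icc a b)} {t : Icc a b}
    (h₁ : g.GContWithin f₁ S t) (h₂ : g.GContWithin f₂ S t) : g.GContWithin (f₁ * f₂) S t :=
  gContWithin_iff_tendsto.2
    ((gContWithin_iff_tendsto.1 h₁).mul (gContWithin_iff_tendsto.1 h₂))

lemma GContWithin.inv {f : Icc a b → 𝕜} {S : Set (Icc a b)} {t : Icc a b}
    (h : g.GContWithin f S t) (h0 : f t ≠ 0) : g.GContWithin f⁻¹ S t :=
  gContWithin_iff_tendsto.2 ((gContWithin_iff_tendsto.1 h).inv₀ h0)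

lemma GContWithin.mono {f : Icc a b → 𝕜} {S S' : Set (Icc a b)} {t : Icc a b}
    (h : g.GContWithin f S t) (hS : S' ⊆ S) : g.GContWithin f S' t := by
  intro ε hε
  obtain ⟨δ, hδ, K⟩ := h ε hε
  exact ⟨δ, hδ, fun s hs => K s (hS hs)⟩

lemma gContWithin_comp {W : ℝ → 𝕜} (hW : Continuous W) (S : Set (Icc a b)) (t : Icc a b) :
    g.GContWithin (fun s => W (g s)) S t :=
  gContWithin_iff_tendsto.2 (((hW.tendsto _).comp tendsto_comap).mono_left inf_le_left)

lemma mem_BD_of_forall_gContWithin {f : Icc a b → 𝕜} {M : ℝ} (hM : ∀ t, ‖f t‖ ≤ M)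
    (h : ∀ t, g.GContWithin f univ t) : f ∈ g.BD 𝕜 a b :=
  ⟨⟨M, hM⟩, fun t _ => h t, fun t _ => (h t).mono (subset_univ _),
    fun t _ => (h t).mono (subset_univ _)⟩

lemma mul_mem_BD {f₁ f₂ : Icc a b → 𝕜} (h₁ : f₁ ∈ g.BD 𝕜 a b) (h₂ : f₂ ∈ g.BD 𝕜 a b) :
    f₁ * f₂ ∈ g.BD 𝕜 a b := by
  obtain ⟨⟨M₁, b₁⟩, i₁, j₁, k₁⟩ := h₁
  obtain ⟨⟨M₂, b₂⟩, i₂, j₂, k₂⟩ := h₂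
  refine ⟨⟨M₁ * M₂, fun t => ?_⟩, fun t ht => (i₁ t ht).mul (i₂ t ht),
    fun t ht => (j₁ t ht).mul (j₂ t ht), fun t ht => (k₁ t ht).mul (k₂ t ht)⟩
  rw [Pi.mul_apply, norm_mul]
  exact mul_le_mul (b₁ t) (b₂ t) (norm_nonneg _) ((norm_nonneg _).trans (b₁ t))

/-- The point `t^*` as an element of `[a, b]`. -/
def Admissible.star (H : g.Admissible a b) (t : Icc a b) : Icc a b := (H.exists_isStar t).choose

lemma Admissible.isStar_star (H : g.Admissible a b) (t : Icc a b) : g.IsStar t (H.star t) :=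
  (H.exists_isStar t).choose_spec

lemma Admissible.star_eq (H : g.Admissible a b) {t : Icc a b} (ht : (t : ℝ) ∉ g.C) :
    H.star t = t :=
  Subtype.ext ((H.isStar_star t).unique (Or.inl ⟨ht, rfl⟩))

lemma GContWithin.comp_star (H : g.Admissible a b) {f : Icc a b → 𝕜} {S : Set (Icc a b)}
    {t : Icc a b} (ht : (t : ℝ) ∉ g.C) (h : g.GContWithin f S t)
    (hS : ∀ s ∈ S, H.star s ∈ S ∨ H.star s = t) : g.GContWithin (f ∘ H.star) S t := by
  intro ε hε
  obtain ⟨δ, hδ, K⟩ := h ε hε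
  refine ⟨δ, hδ, fun s hs hst => ?_⟩
  simp only [Function.comp, H.star_eq ht]
  rcases hS s hs with h1 | h1
  · exact K _ h1 (by rwa [(H.isStar_star s).map_eq])
  · simpa [h1] using hε

/-- Since g(t^*) = g(t), replacing s by s^* does not change `g`-distances. It also respects the
one-sided conditions: s > t gives s^* > t, while for t off `C_g`, s < t gives s^* ≤ t. -/
lemma comp_star_mem_BD (H : g.Admissible a b) {f : Icc a b → 𝕜} (hf : f ∈ g.BD 𝕜 a b) :
    f ∘ H.star ∈ g.BD 𝕜 a b := by
  obtain ⟨⟨M, hM⟩, i, j, k⟩ := hf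
  refine ⟨⟨M, fun t => hM _⟩, fun t ht => ?_, fun t ht => ?_, fun t ht => ?_⟩
  · exact (i t ht).comp_star H (fun h => ht (Or.inl (Or.inl h))) fun s _ => Or.inl (mem_univ _)
  · refine (j t ht).comp_star H ht.1.1 fun s hs => ?_
    exact ((H.isStar_star s).le_of_le ht.1.1 (le_of_lt hs)).lt_or_eq.imp id Subtype.ext
  · exact (k t ht).comp_star H ht.1.1 fun s hs => Or.inl (lt_of_lt_of_le hs (H.isStar_star s).le)

/-- A function in `BD_g` which has a `g`-derivative that is equal off `C_g` to a function
in `BD_g` belongs to `BD¹_g`. -/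
lemma mem_BD1_of_hasGDerivAt (H : g.Admissible a b) {f f' : Icc a b → 𝕜} (hf : f ∈ g.BD 𝕜 a b)
    (hf' : f' ∈ g.BD 𝕜 a b) (h : ∀ t : Icc a b, (t : ℝ) ∉ g.C → g.HasGDerivAt f (f' t) t) :
    f ∈ BD1 𝕜 H :=
  -- The values of f' on `C_g` are arbitrary; the true derivative there is the one at t^*.
  ⟨hf, f' ∘ H.star, comp_star_mem_BD H hf', fun t =>
    (hasGDerivAt_iff_star (H.isStar_star t)).2 (h _ (H.isStar_star t).notMem_C)⟩

lemma mem_ker_gDeriv_iff (H : g.Admissible a b) (h : BD1 𝕜 H) :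
    h ∈ LinearMap.ker (gDeriv 𝕜 H) ↔
      ∀ t : Icc a b, (t : ℝ) ∉ g.C → g.HasGDerivAt (h : Icc a b → 𝕜) 0 t := by
  rw [LinearMap.mem_ker]
  constructor
  · intro h0 t _
    have := hasGDerivAt_gDeriv H h t
    rw [h0] at this
    exact this
  · intro h0
    ext t
    exact (hasGDerivAt_gDeriv H h t).unique H
      ((hasGDerivAt_iff_star (H.isStar_star t)).2 (h0 _ (H.isStar_star t).notMem_C))

/-! ### The measure `μ_g` as an image of Lebesgue measure. -/

lemma measureOn_apply (s : Set (Icc a b)) :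
    g.measureOn a b s = g.measure ((fun s : Icc a b => (s : ℝ)) '' s) :=
  (MeasurableEmbedding.subtype_coe measurableSet_Icc).comap_apply _ _

lemma measureOn_Ico (x y : Icc a b) :
    g.measureOn a b (Ico x y) = ENNReal.ofReal (g y - g x) := by
  rw [measureOn_apply, ← g.measure_Ico]
  congr 1
  ext s
  constructor
  · rintro ⟨s, hs, rfl⟩
    exact hs
  · intro hs
    exact ⟨⟨s, x.2.1.trans hs.1, hs.2.le.trans y.2.2⟩, hs, rfl⟩

variable (g a b) in
/-- The restriction of `μ_g` to `[a, b)`, as a measure on `[a, b]`. -/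
def measureIco : Measure (Icc a b) := (g.measureOn a b).restrict {s | (s : ℝ) < b}

lemma measureIco_restrict_Ico (x y : Icc a b) :
    (g.measureIco a b).restrict (Ico x y) = (g.measureOn a b).restrict (Ico x y) := by
  rw [measureIco, Measure.restrict_restrict measurableSet_Ico, inter_eq_left.2]
  exact fun s hs => lt_of_lt_of_le (Subtype.coe_lt_coe.2 hs.2) y.2.2

/-- The generalized inverse of `g` on `[a, b]`. -/
def quantile (H : g.Admissible a b) (r : ℝ) : Icc a b :=
  -- The truncation `max r (g a)` keeps a in the set, so the function is defined and monotone on all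
  -- of ℝ.
  ⟨sSup {t | t ∈ Icc a b ∧ g t ≤ max r (g a)},
    le_csSup ⟨b, fun _ h => h.1.2⟩ ⟨⟨le_rfl, H.lt.le⟩, le_max_right _ _⟩,
    csSup_le ⟨a, ⟨le_rfl, H.lt.le⟩, le_max_right _ _⟩ fun _ h => h.1.2⟩

/-- Left-continuity of g makes the supremum attained, whence a Galois-type equivalence. -/
lemma le_quantile_iff_max (H : g.Admissible a b) {t : Icc a b} {r : ℝ} :
    t ≤ quantile H r ↔ g t ≤ max r (g a) := by
  set A : Set ℝ := {t | t ∈ Icc a b ∧ g t ≤ max r (g a)} with hA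
  have hne : A.Nonempty := ⟨a, ⟨le_rfl, H.lt.le⟩, le_max_right _ _⟩
  have hbd : BddAbove A := ⟨b, fun _ h => h.1.2⟩
  have hval : (quantile H r : ℝ) = sSup A := rfl
  have hlt : ∀ s < sSup A, g s ≤ max r (g a) := fun s hs => by
    obtain ⟨u, hu, hsu⟩ := exists_lt_of_lt_csSup hne hs
    exact (g.mono hsu.le).trans hu.2
  have hsup : g (sSup A) ≤ max r (g a) := by
    refine le_of_tendsto ((tendsto_nhdsLE _).mono_left (nhdsWithin_mono _ Iio_subset_Iic_self)) ?_
    exact eventually_nhdsWithin_of_forall hlt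
  rw [← Subtype.coe_le_coe, hval]
  exact ⟨fun h => (g.mono h).trans hsup, fun h => le_csSup hbd ⟨t.2, h⟩⟩

lemma le_quantile_iff (H : g.Admissible a b) {t : Icc a b} {r : ℝ} (hr : g a ≤ r) :
    t ≤ quantile H r ↔ g t ≤ r := by
  rw [le_quantile_iff_max, max_eq_left hr]

lemma quantile_lt_iff (H : g.Admissible a b) {t : Icc a b} {r : ℝ} (hr : g a ≤ r) :
    quantile H r < t ↔ r < g t := by
  rw [← not_le, le_quantile_iff H hr, not_le]

lemma map_quantile_le (H : g.Admissible a b) {r : ℝ} (hr : g a ≤ r) : g (quantile H r) ≤ r :=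
  (le_quantile_iff H hr).1 le_rfl

lemma le_map_left (t : Icc a b) : g a ≤ g t := g.mono t.2.1

lemma monotone_quantile (H : g.Admissible a b) : Monotone (quantile H) := fun _ _ h =>
  (le_quantile_iff_max H).2 (((le_quantile_iff_max H).1 le_rfl).trans (max_le_max_right _ h))

lemma measurable_quantile (H : g.Admissible a b) : Measurable (quantile H) :=
  (monotone_quantile H).measurable

/-- Off the jumps, `g` is a left inverse of its generalized inverse. -/
lemma map_quantile_eq (H : g.Admissible a b) {r : ℝ} (hr : r ∈ Ico (g a) (g b))
    (hD : (quantile H r : ℝ) ∉ g.D) : g (quantile H r) = r := by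
  refine le_antisymm (map_quantile_le H hr.1) ?_
  have hlt : quantile H r < ⟨b, H.lt.le, le_rfl⟩ := (quantile_lt_iff H hr.1).2 hr.2
  have := tendsto_nhdsGT (g := g) (quantile H r)
  rw [jump_eq_zero hD, add_zero] at this
  refine ge_of_tendsto this ?_
  filter_upwards [Ioo_mem_nhdsGT (Subtype.coe_lt_coe.2 hlt)] with s hs
  exact ((quantile_lt_iff H hr.1 (t := ⟨s, (quantile H r).2.1.trans hs.1.le, hs.2.le⟩)).1 hs.1).le

/-- It suffices to compare half-lines: the preimage of [c, b) is [g(c), g(b)), whose length is the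
`μ_g`-mass of [c, b). -/
lemma map_quantile_volume (H : g.Admissible a b) :
    (volume.restrict (Ico (g a) (g b))).map (quantile H) = g.measureIco a b := by
  have hm := measurable_quantile H
  refine Measure.ext_of_Ici _ _ fun c => ?_
  rw [Measure.map_apply hm measurableSet_Ici,
    Measure.restrict_apply (hm measurableSet_Ici), measureIco,
    Measure.restrict_apply measurableSet_Ici]
  have e1 : Ici c ∩ {s : Icc a b | (s : ℝ) < b} = Ico c ⟨b, H.lt.le, le_rfl⟩ := rfl
  have e2 : quantile H ⁻¹' Ici c ∩ Ico (g a) (g b) = Ico (g c) (g b) := by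
    ext r
    constructor
    · rintro ⟨h1, h2⟩
      exact ⟨(le_quantile_iff H h2.1).1 h1, h2.2⟩
    · rintro ⟨h1, h2⟩
      have h3 := (le_map_left c).trans h1
      exact ⟨(le_quantile_iff H h3).2 h1, h3, h2⟩
  rw [e1, e2, measureOn_Ico, Real.volume_Ico]

instance : IsFiniteMeasure (g.measureIco a b) := by
  refine ⟨?_⟩
  rw [measureIco, Measure.restrict_apply_univ, measureOn_apply]
  refine lt_of_le_of_lt (measure_mono (t := Ico a b) ?_) ?_
  · rintro _ ⟨s, hs, rfl⟩
    exact ⟨s.2.1, hs⟩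
  · rw [g.measure_Ico]
    exact ENNReal.ofReal_lt_top

lemma setIntegral_Ico_eq (H : g.Admissible a b) {f : Icc a b → 𝕜}
    (hf : AEStronglyMeasurable f (g.measureIco a b)) {x y : Icc a b} (hxy : x ≤ y) :
    ∫ s in Ico x y, f s ∂(g.measureOn a b) = ∫ r in (g x)..(g y), f (quantile H r) := by
  have hm := measurable_quantile H
  rw [← measureIco_restrict_Ico, ← map_quantile_volume H,
    setIntegral_map measurableSet_Ico (by rwa [map_quantile_volume]) hm.aemeasurable,
    Measure.restrict_restrict (hm measurableSet_Ico),
    intervalIntegral.integral_of_le (g.mono hxy), ← integral_Ico_eq_integral_Ioc]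
  congr 2
  ext r
  constructor
  · rintro ⟨⟨h1, h2⟩, h3⟩
    exact ⟨(le_quantile_iff H h3.1).1 h1, (quantile_lt_iff H h3.1).1 h2⟩
  · rintro ⟨h1, h2⟩
    have h3 := (le_map_left x).trans h1
    exact ⟨⟨(le_quantile_iff H h3).2 h1, (quantile_lt_iff H h3).2 h2⟩, h3,
      h2.trans_le (g.mono y.2.2)⟩

lemma intervalIntegrable_comp_quantile (H : g.Admissible a b) {f : Icc a b → 𝕜}
    (hf : Integrable f (g.measureIco a b)) :
    IntervalIntegrable (fun r => f (quantile H r)) volume (g a) (g b) := by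
  rw [intervalIntegrable_iff_integrableOn_Ico_of_le (g.mono H.lt.le)]
  rw [← map_quantile_volume H] at hf
  exact hf.comp_measurable (measurable_quantile H)

/-- Almost every point which is not a jump of `g` is recovered from its image under `g`, and this
image avoids any given Lebesgue null set. -/
lemma ae_quantile_map (H : g.Admissible a b) {p : ℝ → Prop} (hp : ∀ᵐ r : ℝ, p r) :
    ∀ᵐ t : Icc a b ∂(g.measureIco a b),
      (t : ℝ) ∈ g.D ∨ (quantile H (g t) = t ∧ p (g t)) := by
  have hmq := measurable_quantile H
  obtain ⟨N, hpN, hN, hN0⟩ := exists_measurable_superset_of_null (ae_iff.1 hp)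
  have hmg : Measurable fun t : Icc a b => g t := g.mono.measurable.comp measurable_subtype_coe
  have key : ∀ᵐ t : Icc a b ∂(g.measureIco a b),
      (t : ℝ) ∈ g.D ∨ (quantile H (g t) = t ∧ g t ∉ N) := by
    have hms : MeasurableSet {t : Icc a b | (t : ℝ) ∈ g.D ∨ (quantile H (g t) = t ∧ g t ∉ N)} :=
      (measurable_subtype_coe countable_D.measurableSet).union
        ((measurableSet_eq_fun (hmq.comp hmg) measurable_id).inter (hmg hN.compl))
    -- Almost every t is Q(r) for a generic r, and off the jumps g(Q(r)) = r.
    rw [← map_quantile_volume H, ae_map_iff hmq.aemeasurable hms,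
      ae_restrict_iff' measurableSet_Ico]
    filter_upwards [measure_eq_zero_iff_ae_notMem.1 hN0] with r hr hI
    refine or_iff_not_imp_left.2 fun hD => ?_
    rw [map_quantile_eq H hI hD]
    exact ⟨rfl, hr⟩
  filter_upwards [key] with t ht
  refine ht.imp_right fun h => ⟨h.1, not_not.1 fun hnp => h.2 (hpN hnp)⟩

/-- A point with Q(g(t)) = t is the last one at its level of g, whereas a point of `C_g` is followed
by t^* at the same level. -/
lemma ae_notMem_C (H : g.Admissible a b) :
    ∀ᵐ t : Icc a b ∂(g.measureIco a b), (t : ℝ) ∉ g.C := by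
  filter_upwards [ae_quantile_map H (p := fun _ => True) (by simp)] with t ht hC
  rcases ht with hD | ⟨h, -⟩
  · exact notMem_D_of_mem_C hC hD
  · have h1 : H.star t ≤ quantile H (g t) :=
      (le_quantile_iff H (le_map_left t)).2 (H.isStar_star t).map_eq.le
    rw [h] at h1
    have h2 : H.star t = t := le_antisymm h1 (H.isStar_star t).le
    have h3 := (H.isStar_star t).notMem_C
    rw [h2] at h3
    exact h3 hC

lemma sub_eq_intervalIntegral (H : g.Admissible a b) {u f : Icc a b → 𝕜}
    (hf : AEStronglyMeasurable f (g.measureIco a b))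
    (hu : ∀ x y : Icc a b, x ≤ y → u y - u x = ∫ s in Ico x y, f s ∂(g.measureOn a b))
    (x y : Icc a b) : u y - u x = ∫ r in (g x)..(g y), f (quantile H r) := by
  rcases le_total x y with h | h
  · rw [hu x y h, setIntegral_Ico_eq H hf h]
  · rw [intervalIntegral.integral_symm, ← setIntegral_Ico_eq H hf h, ← hu y x h, neg_sub]

lemma map_mem_uIcc (H : g.Admissible a b) (t : Icc a b) : g t ∈ uIcc (g a) (g b) := by
  rw [uIcc_of_le (g.mono H.lt.le)]
  exact ⟨g.mono t.2.1, g.mono t.2.2⟩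

/-! ### Derivatives of indefinite integrals. -/

/-- The right limits of indefinite integrals with respect to `μ_g`. -/
lemma tendsto_nhdsGT_of_integral (H : g.Admissible a b) {u f : Icc a b → 𝕜}
    (hf : Integrable f (g.measureIco a b))
    (hu : ∀ x y : Icc a b, x ≤ y → u y - u x = ∫ s in Ico x y, f s ∂(g.measureOn a b))
    {t : Icc a b} (ht : (t : ℝ) < b) :
    Tendsto u (𝓝[>] t) (𝓝 (u t + f t * g.jump t)) := by
  have hint := intervalIntegrable_comp_quantile H hf
  have hcont := intervalIntegral.continuousOn_primitive_interval' hint (map_mem_uIcc H t)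
  have hmem : g t + g.jump t ∈ uIcc (g a) (g b) := by
    rw [uIcc_of_le (g.mono H.lt.le)]
    exact ⟨(le_map_left t).trans (le_add_of_nonneg_right (jump_nonneg _)), add_jump_le ht⟩
  -- A jump at t opens the gap [g(t), g(t) + Δg(t)) on the r-axis, and Q is constantly t on it.
  have hconst : ∫ r in (g t)..(g t + g.jump t), f (quantile H r) = f t * g.jump t := by
    rw [intervalIntegral.integral_of_le (le_add_of_nonneg_right (jump_nonneg _)),
      ← integral_Ico_eq_integral_Ioc, setIntegral_congr_fun (g := fun _ => f t) measurableSet_Ico]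
    · rw [setIntegral_const, measureReal_def, Real.volume_Ico, add_sub_cancel_left,
        ENNReal.toReal_ofReal (jump_nonneg _), RCLike.real_smul_eq_coe_mul, mul_comm]
    · intro r hr
      have hr0 := (le_map_left t).trans hr.1
      have : quantile H r = t := by
        refine le_antisymm (not_lt.1 fun h => ?_) ((le_quantile_iff H hr0).2 hr.1)
        have h1 := add_jump_le (g := g) (Subtype.coe_lt_coe.2 h)
        exact absurd hr.2 (not_lt.2 (h1.trans (map_quantile_le H hr0)))
      simp only [this]
  have hg : Tendsto (fun s : Icc a b => g s) (𝓝[>] t) (𝓝[uIcc (g a) (g b)] (g t + g.jump t)) :=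
    tendsto_nhdsWithin_of_tendsto_nhds_of_eventually_within _
      ((tendsto_nhdsGT _).comp (tendsto_coe_nhdsGT t))
      (Eventually.of_forall fun s => map_mem_uIcc H s)
  have h1 := ((hcont _ hmem).tendsto.comp hg).const_add (u t)
  rw [hconst] at h1
  refine h1.congr fun s => ?_
  rw [Function.comp, ← sub_eq_intervalIntegral H hf.aestronglyMeasurable hu, add_sub_cancel]

lemma Admissible.lt_of_mem_D (H : g.Admissible a b) {t : Icc a b} (ht : (t : ℝ) ∈ g.D) :
    (t : ℝ) < b :=
  lt_of_le_of_ne t.2.2 fun h => H.right (Or.inl (Or.inr (h ▸ ht)))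

/-- Indefinite integrals with respect to `μ_g` have the expected derivative at the jumps of `g`. -/
lemma hasGDerivAt_of_mem_D (H : g.Admissible a b) {u f : Icc a b → 𝕜}
    (hf : Integrable f (g.measureIco a b))
    (hu : ∀ x y : Icc a b, x ≤ y → u y - u x = ∫ s in Ico x y, f s ∂(g.measureOn a b))
    {t : Icc a b} (ht : (t : ℝ) ∈ g.D) : g.HasGDerivAt u (f t) t := by
  have hC : (t : ℝ) ∉ g.C := fun h => notMem_D_of_mem_C h ht
  have h0 : (g.jump t : 𝕜) ≠ 0 := RCLike.ofReal_ne_zero.2 (ne_of_gt ht)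
  have e : g.derivFilter t = 𝓝[>] t := by simp [derivFilter, ht]
  rw [hasGDerivAt_iff hC]
  have h1 := tendsto_nhdsGT_of_integral H hf hu (H.lt_of_mem_D ht)
  rw [← e] at h1
  have h2 := (h1.sub_const (u t)).div (tendsto_sub_derivFilter (g := g) t) h0
  rwa [add_sub_cancel_left, mul_div_cancel_right₀ _ h0] at h2

/-- Lebesgue differentiation theorem for indefinite integrals with respect to `μ_g`. -/
lemma ae_hasGDerivAt_of_integral (H : g.Admissible a b) {u f : Icc a b → 𝕜}
    (hf : Integrable f (g.measureIco a b))
    (hu : ∀ x y : Icc a b, x ≤ y → u y - u x = ∫ s in Ico x y, f s ∂(g.measureOn a b)) :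
    ∀ᵐ t : Icc a b ∂(g.measureIco a b), g.HasGDerivAt u (f t) t := by
  have hint := intervalIntegrable_comp_quantile H hf
  filter_upwards [ae_quantile_map H hint.ae_hasDerivAt_integral, ae_notMem_C H] with t ht hC
  by_cases hD : (t : ℝ) ∈ g.D
  · exact hasGDerivAt_of_mem_D H hf hu hD
  obtain ⟨hq, hd⟩ := ht.resolve_left hD
  have hd := hd (map_mem_uIcc H t) (g t) (map_mem_uIcc H t)
  rw [hq, hasDerivAt_iff_tendsto_slope] at hd
  -- At a continuity point, g(s) tends to g(t) without taking that value, so the slope on the r-axis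
  -- composes with g.
  have hg : Tendsto (fun s : Icc a b => g s) (g.derivFilter t) (𝓝[≠] (g t)) := by
    refine tendsto_nhdsWithin_of_tendsto_nhds_of_eventually_within _ ?_
      (eventually_ne_derivFilter t)
    have := tendsto_derivFilter (g := g) t
    rwa [jump_eq_zero hD, add_zero] at this
  rw [hasGDerivAt_iff hC]
  refine (hd.comp hg).congr fun s => ?_
  rw [Function.comp, slope_def_module, intervalIntegral.integral_same, sub_zero,
    ← sub_eq_intervalIntegral H hf.aestronglyMeasurable hu, RCLike.real_smul_eq_coe_mul,
    RCLike.ofReal_inv, div_eq_inv_mul]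

/-- Off `C_g ∪ N_g ∪ D_g` the function is continuous in the ordinary sense, because g is. The sets
`N_g` and `D_g` are countable and `C_g` is null. -/
lemma aestronglyMeasurable_of_mem_BD (H : g.Admissible a b) {f : Icc a b → 𝕜}
    (hf : f ∈ g.BD 𝕜 a b) : AEStronglyMeasurable f (g.measureIco a b) := by
  classical
  have hmC : MeasurableSet g.C := isOpen_C.measurableSet
  set A : Set (Icc a b) := {t | (t : ℝ) ∉ g.C ∪ g.N ∪ g.D} with hA
  have hmA : MeasurableSet A := measurable_subtype_coe
    ((hmC.union countable_N.measurableSet).union countable_D.measurableSet).compl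
  have hcont : ContinuousOn f A := fun t ht => by
    have h1 := gContWithin_iff_tendsto.1 (hf.2.1 t ht)
    rw [principal_univ, inf_top_eq] at h1
    refine ContinuousAt.continuousWithinAt (h1.mono_left (tendsto_iff_comap.1 ?_))
    exact (continuousAt_of_notMem_D fun h => ht (Or.inr h)).tendsto.comp
      continuous_subtype_val.continuousAt
  have hm : Measurable (A.piecewise f 0) := hcont.measurable_piecewise continuousOn_const hmA
  have hm' : Measurable ({t : Icc a b | (t : ℝ) ∈ g.C}.piecewise 0 f) := by
    refine hm.measurable_of_countable_ne ?_
    refine (((countable_N (g := g)).union (countable_D (g := g))).preimage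
      Subtype.val_injective).mono ?_
    intro t ht
    by_contra hcon
    refine ht ?_
    by_cases hC : (t : ℝ) ∈ g.C
    · have : t ∉ A := fun h => h (Or.inl (Or.inl hC))
      simp [this, hC]
    · have : t ∈ A := fun h => h.elim (fun h => h.elim hC fun h => hcon (Or.inl h))
        fun h => hcon (Or.inr h)
      simp [this, hC]
  refine hm'.aestronglyMeasurable.congr ?_
  filter_upwards [ae_notMem_C H] with t ht
  simp [ht]

lemma integrable_of_mem_BD (H : g.Admissible a b) {f : Icc a b → 𝕜} (hf : f ∈ g.BD 𝕜 a b) :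
    Integrable f (g.measureIco a b) := by
  obtain ⟨M, hM⟩ := hf.1
  exact Integrable.of_bound (aestronglyMeasurable_of_mem_BD H hf) M (Eventually.of_forall hM)

/-! ### From almost everywhere to everywhere off `C_g`. -/

/-- An interval of positive `μ_g`-measure meets every set of full measure. -/
lemma exists_of_ae {p : Icc a b → Prop} (hp : ∀ᵐ t ∂(g.measureIco a b), p t) {x y : Icc a b}
    (hxy : g x < g y) : ∃ r ∈ Ico x y, p r := by
  by_contra hcon
  have h1 := ae_restrict_of_ae (s := Ico x y) hp
  rw [measureIco_restrict_Ico, ae_restrict_iff' measurableSet_Ico] at h1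
  have h2 : g.measureOn a b (Ico x y) = 0 :=
    measure_mono_null (fun r hr (h : r ∈ Ico x y → p r) => hcon ⟨r, hr, h hr⟩) (ae_iff.1 h1)
  rw [measureOn_Ico, ENNReal.ofReal_eq_zero] at h2
  linarith

/-- Points of `D_g` are atoms. Were {t} negligible, its indicator would integrate to 0, yet the
integral has derivative 1 at t. -/
lemma of_ae_of_mem_D (H : g.Admissible a b) {p : Icc a b → Prop}
    (hp : ∀ᵐ t ∂(g.measureIco a b), p t) {t : Icc a b} (ht : (t : ℝ) ∈ g.D) : p t := by
  classical
  by_contra hcon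
  set f : Icc a b → ℝ := indicator {t} 1 with hf
  have h0 : f =ᵐ[g.measureIco a b] 0 := by
    filter_upwards [hp] with r hr
    have : r ≠ t := fun h => hcon (h ▸ hr)
    simp [hf, this]
  have h1 : g.HasGDerivAt (0 : Icc a b → ℝ) (f t) t := by
    refine hasGDerivAt_of_mem_D H ((integrable_zero _ _ _).congr h0.symm) (fun x y _ => ?_) ht
    rw [← measureIco_restrict_Ico, integral_congr_ae (ae_restrict_of_ae h0)]
    simp
  have h2 := h1.unique H (HasGDerivAt.zero H t)
  simp [hf] at h2

/-- Functions in `BD_g` are nearly constant on the short intervals which enter the difference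
quotients at a point `t ∉ C_g ∪ D_g`. -/
lemma eventually_uIcc_norm_sub_lt {f : Icc a b → 𝕜} (hf : f ∈ g.BD 𝕜 a b) {t : Icc a b}
    (hC : (t : ℝ) ∉ g.C) (hD : (t : ℝ) ∉ g.D) {ε : ℝ} (hε : 0 < ε) :
    ∀ᶠ s in g.derivFilter t, ∀ r ∈ uIcc s t, ‖f t - f r‖ < ε := by
  -- At a point of `N_g⁻` (`N_g⁺`) g is flat on the right (left), so quotients exist only on the
  -- side where `BD_g` demands `g`-continuity.
  have key : ∃ S, g.GContWithin f S t ∧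
      ∀ᶠ s in g.derivFilter t, ∀ r ∈ uIcc s t, r ≠ t → r ∈ S := by
    have hle : g.derivFilter t ≤ 𝓝 t := by
      rw [derivFilter, if_neg hD]
      exact nhdsWithin_le_nhds
    have hval : Tendsto (fun s : Icc a b => (s : ℝ)) (g.derivFilter t) (𝓝 t) :=
      continuous_subtype_val.continuousAt.mono_left hle
    by_cases hm : (t : ℝ) ∈ g.Nminus
    · refine ⟨Iio t, hf.2.2.1 t hm, ?_⟩
      obtain ⟨d, hd, K⟩ := exists_eq_right_of_mem_Nminus hm
      filter_upwards [eventually_ne_derivFilter t, hval (Iio_mem_nhds hd)] with s hs hsd r hr hrt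
      have hst : s ≤ t := not_lt.1 fun h => hs (K s ⟨h, hsd⟩)
      rw [uIcc_of_le hst] at hr
      exact lt_of_le_of_ne hr.2 hrt
    by_cases hp : (t : ℝ) ∈ g.Nplus
    · refine ⟨Ioi t, hf.2.2.2 t hp, ?_⟩
      obtain ⟨d, hd, K⟩ := exists_eq_left_of_mem_Nplus hp
      filter_upwards [eventually_ne_derivFilter t, hval (Ioi_mem_nhds hd)] with s hs hsd r hr hrt
      have hst : t ≤ s := not_lt.1 fun h => hs (K s ⟨hsd, h⟩)
      rw [uIcc_of_ge hst] at hr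
      exact lt_of_le_of_ne hr.1 hrt.symm
    · refine ⟨univ, hf.2.1 t fun h => ?_, Eventually.of_forall fun _ _ _ _ => mem_univ _⟩
      exact h.elim (fun h => h.elim hC fun h => h.elim hm hp) hD
  obtain ⟨S, hS, hev⟩ := key
  obtain ⟨δ, hδ, K⟩ := hS ε hε
  have hg := tendsto_derivFilter (g := g) t
  rw [jump_eq_zero hD, add_zero] at hg
  filter_upwards [hev, hg (Metric.ball_mem_nhds _ hδ)] with s hs hsδ r hr
  rcases eq_or_ne r t with rfl | hrt
  · simpa using hε
  refine K r (hs r hr hrt) (lt_of_le_of_lt ?_ (by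
    rwa [mem_preimage, Metric.mem_ball, dist_comm, Real.dist_eq] at hsδ))
  have hmono : Monotone fun s : Icc a b => g s := fun _ _ h => g.mono h
  exact abs_sub_right_of_mem_uIcc (hmono.mapsTo_uIcc hr)

/-- Functions in `BD_g` which agree `g`-almost everywhere agree off `C_g`. -/
lemma eq_of_ae_eq (H : g.Admissible a b) {f₁ f₂ : Icc a b → 𝕜} (h₁ : f₁ ∈ g.BD 𝕜 a b)
    (h₂ : f₂ ∈ g.BD 𝕜 a b) (h : ∀ᵐ t ∂(g.measureIco a b), f₁ t = f₂ t) {t : Icc a b}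
    (hC : (t : ℝ) ∉ g.C) : f₁ t = f₂ t := by
  by_cases hD : (t : ℝ) ∈ g.D
  · exact of_ae_of_mem_D H h hD
  have hne : (g.derivFilter t).NeBot := by
    rw [derivFilter, if_neg hD]
    exact H.neBot fun h => h.elim hD hC
  refine eq_of_forall_dist_le fun ε hε => ?_
  obtain ⟨s, hs₁, hs₂, hs⟩ := ((eventually_uIcc_norm_sub_lt h₁ hC hD (half_pos hε)).and
    ((eventually_uIcc_norm_sub_lt h₂ hC hD (half_pos hε)).and
      (eventually_ne_derivFilter t))).exists
  -- As g(s) ≠ g(t), the interval between them has positive measure and contains a point where the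
  -- two functions agree.
  have hr : ∃ r ∈ uIcc s t, f₁ r = f₂ r := by
    rcases hs.lt_or_gt with hlt | hlt
    · obtain ⟨r, hr, e⟩ := exists_of_ae h hlt
      exact ⟨r, Icc_subset_uIcc ⟨hr.1, hr.2.le⟩, e⟩
    · obtain ⟨r, hr, e⟩ := exists_of_ae h hlt
      exact ⟨r, Icc_subset_uIcc' ⟨hr.1, hr.2.le⟩, e⟩
  obtain ⟨r, hr, e⟩ := hr
  have i₁ := hs₁ r hr
  have i₂ := hs₂ r hr
  rw [← e] at i₂
  have i₃ := norm_sub_le (f₁ t - f₁ r) (f₂ t - f₁ r)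
  rw [sub_sub_sub_cancel_right] at i₃
  rw [dist_eq_norm]
  linarith

/-- Indefinite integrals of functions in `BD_g` are `g`-differentiable off `C_g`. -/
lemma hasGDerivAt_of_mem_BD (H : g.Admissible a b) {u f : Icc a b → 𝕜} (hf : f ∈ g.BD 𝕜 a b)
    (hu : ∀ x y : Icc a b, x ≤ y → u y - u x = ∫ s in Ico x y, f s ∂(g.measureOn a b))
    {t : Icc a b} (hC : (t : ℝ) ∉ g.C) : g.HasGDerivAt u (f t) t := by
  have hint := integrable_of_mem_BD H hf
  by_cases hD : (t : ℝ) ∈ g.D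
  · exact hasGDerivAt_of_mem_D H hint hu hD
  -- The left side is the integral of f - f(t) over [x, y).
  have est : ∀ x y : Icc a b, x ≤ y → ∀ ε, (∀ r ∈ Icc x y, ‖f t - f r‖ < ε) →
      ‖u y - u x - f t * ((g y - g x : ℝ) : 𝕜)‖ ≤ ε * (g y - g x) := by
    intro x y hxy ε hε
    have hgxy : 0 ≤ g y - g x := sub_nonneg.2 (g.mono hxy)
    have hfin : g.measureOn a b (Ico x y) < ⊤ := by
      rw [measureOn_Ico]
      exact ENNReal.ofReal_lt_top
    have hreal : (g.measureOn a b).real (Ico x y) = g y - g x := by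
      rw [measureReal_def, measureOn_Ico, ENNReal.toReal_ofReal hgxy]
    have hI : IntegrableOn f (Ico x y) (g.measureOn a b) := by
      rw [IntegrableOn, ← measureIco_restrict_Ico]
      exact hint.restrict
    have e : f t * ((g y - g x : ℝ) : 𝕜) = ∫ _ in Ico x y, f t ∂(g.measureOn a b) := by
      rw [setIntegral_const, hreal, RCLike.real_smul_eq_coe_mul, mul_comm]
    rw [hu x y hxy, e, ← integral_sub hI (integrableOn_const hfin.ne), ← hreal]
    refine norm_setIntegral_le_of_norm_le_const hfin fun r hr => ?_
    rw [norm_sub_rev]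
    exact (hε r ⟨hr.1, hr.2.le⟩).le
  rw [hasGDerivAt_iff hC, Metric.tendsto_nhds]
  intro ε hε
  filter_upwards [eventually_uIcc_norm_sub_lt hf hC hD (half_pos hε),
    eventually_ne_derivFilter t] with s hs hne
  have hne' : ((g s - g t : ℝ) : 𝕜) ≠ 0 := by exact_mod_cast sub_ne_zero.2 hne
  have hpos : 0 < |g s - g t| := abs_pos.2 (sub_ne_zero.2 hne)
  have h1 : ‖u s - u t - f t * ((g s - g t : ℝ) : 𝕜)‖ ≤ ε / 2 * |g s - g t| := by
    rcases le_total t s with h | h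
    · rw [abs_of_nonneg (sub_nonneg.2 (g.mono h))]
      exact est t s h _ fun r hr => hs r (Icc_subset_uIcc' hr)
    · rw [abs_sub_comm, abs_of_nonneg (sub_nonneg.2 (g.mono h))]
      have e : u s - u t - f t * ((g s - g t : ℝ) : 𝕜) =
          -(u t - u s - f t * ((g t - g s : ℝ) : 𝕜)) := by
        push_cast
        ring
      rw [e, norm_neg]
      exact est s t h _ fun r hr => hs r (Icc_subset_uIcc hr)
  have e : (u s - u t) / ((g s - g t : ℝ) : 𝕜) - f t =
      (u s - u t - f t * ((g s - g t : ℝ) : 𝕜)) / ((g s - g t : ℝ) : 𝕜) := by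
    field_simp
  rw [dist_eq_norm, e, norm_div, RCLike.norm_ofReal]
  calc _ ≤ ε / 2 * |g s - g t| / |g s - g t| := by gcongr
    _ = ε / 2 := by field_simp
    _ < ε := half_lt_self hε

end Derivator

/-! ### Linear Volterra equations with delay. -/

/-- Data of a linear Volterra equation `W r = 1 + ∫ s in α..ω, B s * W (G s)` with a bounded
coefficient `B` and a delayed argument `G s ≤ s`. -/
structure DelayVolterra (𝕜 : Type*) [RCLike 𝕜] (α ω : ℝ) where
  le : α ≤ ω
  B : ℝ → 𝕜
  G : ℝ → ℝ
  M : ℝ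
  measurable_B : AEStronglyMeasurable B (volume.restrict (Ioc α ω))
  norm_B_le : ∀ s, ‖B s‖ ≤ M
  measurable_G : Measurable G
  G_le : ∀ s ∈ Icc α ω, G s ≤ s

namespace DelayVolterra

variable {𝕜 : Type*} [RCLike 𝕜] {α ω : ℝ} (E : DelayVolterra 𝕜 α ω)

/-- The integrand of the equation. -/
def integrand (φ : C(Icc α ω, 𝕜)) (s : ℝ) : 𝕜 := E.B s * φ (projIcc α ω E.le (E.G s))

lemma intervalIntegrable_integrand (φ : C(Icc α ω, 𝕜)) :
    IntervalIntegrable (E.integrand φ) volume α ω := by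
  rw [intervalIntegrable_iff_integrableOn_Ioc_of_le E.le]
  have hm : AEStronglyMeasurable (E.integrand φ) (volume.restrict (Ioc α ω)) := by
    refine E.measurable_B.mul (Measurable.aestronglyMeasurable ?_)
    exact (φ.continuous.comp continuous_projIcc).measurable.comp E.measurable_G
  refine Integrable.of_bound hm (E.M * ‖φ‖) (Eventually.of_forall fun s => ?_)
  rw [integrand, norm_mul]
  exact mul_le_mul (E.norm_B_le s) (φ.norm_coe_le_norm _) (norm_nonneg _)
    ((norm_nonneg _).trans (E.norm_B_le s))

/-- The integral operator of the equation. -/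
def next (φ : C(Icc α ω, 𝕜)) : C(Icc α ω, 𝕜) where
  toFun r := 1 + ∫ s in α..r, E.integrand φ s
  continuous_toFun := by
    have h := intervalIntegral.continuousOn_primitive_interval' (E.intervalIntegrable_integrand φ)
      left_mem_uIcc
    rw [uIcc_of_le E.le] at h
    exact continuous_const.add (continuousOn_iff_continuous_domRestrict.1 h)

lemma next_apply (φ : C(Icc α ω, 𝕜)) (r : Icc α ω) :
    E.next φ r = 1 + ∫ s in α..r, E.integrand φ s := rfl

/-- The delay only helps: the bound is increasing in r and G(s) ≤ s, so the induction integrates (s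
- α)^n exactly as for the equation without delay. -/
lemma norm_iterate_sub_le (φ ψ : C(Icc α ω, 𝕜)) (n : ℕ) (r : Icc α ω) :
    ‖E.next^[n] φ r - E.next^[n] ψ r‖ ≤
      (E.M * (r - α)) ^ n / n.factorial * dist φ ψ := by
  have hM : 0 ≤ E.M := (norm_nonneg _).trans (E.norm_B_le 0)
  induction n generalizing r with
  | zero => simpa [dist_eq_norm] using ContinuousMap.dist_apply_le_dist (f := φ) (g := ψ) r
  | succ n ih =>
    have hsub : uIcc α r ⊆ uIcc α ω := by
      rw [uIcc_of_le r.2.1, uIcc_of_le E.le]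
      exact Icc_subset_Icc_right r.2.2
    rw [Function.iterate_succ_apply', Function.iterate_succ_apply', next_apply, next_apply,
      add_sub_add_left_eq_sub, ← intervalIntegral.integral_sub
        ((E.intervalIntegrable_integrand _).mono_set hsub)
        ((E.intervalIntegrable_integrand _).mono_set hsub)]
    have hb : ∀ s ∈ Ioc α (r : ℝ),
        ‖E.integrand (E.next^[n] φ) s - E.integrand (E.next^[n] ψ) s‖ ≤
          E.M ^ (n + 1) / n.factorial * dist φ ψ * (s - α) ^ n := by
      intro s hs
      have hs' : s ∈ Icc α ω := ⟨hs.1.le, hs.2.trans r.2.2⟩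
      -- Clamping to [α, ω] cannot push G(s) beyond s, because α < s.
      have hp : (projIcc α ω E.le (E.G s) : ℝ) ≤ s := by
        rw [coe_projIcc]
        exact max_le hs.1.le ((min_le_right _ _).trans (E.G_le s hs'))
      have hp' : 0 ≤ (projIcc α ω E.le (E.G s) : ℝ) - α :=
        sub_nonneg.2 (projIcc α ω E.le (E.G s)).2.1
      rw [integrand, integrand, ← mul_sub, norm_mul]
      calc _ ≤ E.M * ((E.M * ((projIcc α ω E.le (E.G s) : ℝ) - α)) ^ n / n.factorial *
            dist φ ψ) := mul_le_mul (E.norm_B_le s) (ih _) (norm_nonneg _) hM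
        _ ≤ E.M * ((E.M * (s - α)) ^ n / n.factorial * dist φ ψ) := by gcongr
        _ = _ := by rw [mul_pow]; ring
    refine (intervalIntegral.norm_integral_le_of_norm_le r.2.1 (Eventually.of_forall hb)
      (Continuous.intervalIntegrable (by fun_prop) _ _)).trans (le_of_eq ?_)
    rw [intervalIntegral.integral_const_mul,
      intervalIntegral.integral_comp_sub_right (fun x => x ^ n) α, integral_pow,
      Nat.factorial_succ, mul_pow]
    push_cast
    have : ((n : ℝ) + 1) ≠ 0 := by positivity
    have : (n.factorial : ℝ) ≠ 0 := by positivity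
    field_simp
    simp

lemma exists_contractingWith : ∃ (n : ℕ) (K : NNReal), ContractingWith K E.next^[n] := by
  have hM : 0 ≤ E.M := (norm_nonneg _).trans (E.norm_B_le 0)
  have hω : 0 ≤ ω - α := sub_nonneg.2 E.le
  obtain ⟨n, hn⟩ := ((FloorSemiring.tendsto_pow_div_factorial_atTop
    (E.M * (ω - α))).eventually_lt_const zero_lt_one).exists
  have h0 : 0 ≤ (E.M * (ω - α)) ^ n / n.factorial := by positivity
  refine ⟨n, ⟨_, h0⟩, hn, LipschitzWith.of_dist_le_mul fun φ ψ => ?_⟩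
  rw [ContinuousMap.dist_le (by positivity)]
  intro r
  rw [dist_eq_norm]
  refine (E.norm_iterate_sub_le φ ψ n r).trans ?_
  have h1 : 0 ≤ (r : ℝ) - α := sub_nonneg.2 r.2.1
  have h2 : (r : ℝ) ≤ ω := r.2.2
  change _ ≤ (E.M * (ω - α)) ^ n / n.factorial * dist φ ψ
  gcongr

theorem existsUnique_fixedPoint : ∃! φ, Function.IsFixedPt E.next φ := by
  obtain ⟨n, K, hK⟩ := E.exists_contractingWith
  refine ⟨_, hK.isFixedPt_fixedPoint_iterate, fun φ hφ => ?_⟩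
  exact hK.fixedPoint_unique (hφ.iterate n)

end DelayVolterra

/-! ### The integral equation of (P) and its solution. -/

namespace Derivator

variable {g : Derivator} {a b : ℝ} {𝕜 : Type*} [RCLike 𝕜]

/-- The integral equation of `v'_g = β v`, `v(a) = 1`, in the time scale of `g`. -/
def volterra (H : g.Admissible a b) {β : Icc a b → 𝕜} (hβ : β ∈ g.BD 𝕜 a b) :
    DelayVolterra 𝕜 (g a) (g b) where
  le := g.mono H.lt.le
  B r := β (quantile H r)
  -- Across the gap of a jump at t this stays equal to g(t), so the equation uses the value of v
  -- before the jump.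
  G r := g (quantile H r)
  M := hβ.1.choose
  measurable_B := by
    rw [← restrict_Ico_eq_restrict_Ioc]
    have := aestronglyMeasurable_of_mem_BD H hβ
    rw [← map_quantile_volume H] at this
    exact this.comp_measurable (measurable_quantile H)
  norm_B_le s := hβ.1.choose_spec _
  measurable_G := g.mono.measurable.comp
    (measurable_subtype_coe.comp (measurable_quantile H))
  G_le s hs := map_quantile_le H hs.1

/-- `v` solves the integral equation `v(t) = 1 + ∫_{[a, t)} β v dμ_g`. -/
structure IsIntegralSolution (H : g.Admissible a b) (β v : Icc a b → 𝕜) : Prop where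
  start : v H.start = 1
  integrable : Integrable (β * v) (g.measureIco a b)
  sub_eq : ∀ x y : Icc a b, x ≤ y → v y - v x = ∫ s in Ico x y, (β * v) s ∂(g.measureOn a b)

lemma map_mem_Icc (t : Icc a b) : g t ∈ Icc (g a) (g b) := ⟨g.mono t.2.1, g.mono t.2.2⟩

lemma volterra_integrand (H : g.Admissible a b) {β : Icc a b → 𝕜} (hβ : β ∈ g.BD 𝕜 a b)
    (φ : C(Icc (g a) (g b), 𝕜)) (r : ℝ) :
    (volterra H hβ).integrand φ r =
      (β * fun t : Icc a b => φ ⟨g t, map_mem_Icc t⟩) (quantile H r) := by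
  rw [DelayVolterra.integrand, Pi.mul_apply]
  congr 2
  exact projIcc_of_mem _ (map_mem_Icc (quantile H r))

lemma gContWithin_comp_continuousMap (H : g.Admissible a b) (φ : C(Icc (g a) (g b), 𝕜))
    (t : Icc a b) : g.GContWithin (fun t : Icc a b => φ ⟨g t, map_mem_Icc t⟩) univ t := by
  have := gContWithin_comp (g := g) (W := IccExtend (g.mono H.lt.le) φ)
    (φ.continuous.Icc_extend') univ t
  convert this using 2 with s
  exact (IccExtend_of_mem _ _ (map_mem_Icc s)).symm

lemma comp_continuousMap_mem_BD (H : g.Admissible a b) (φ : C(Icc (g a) (g b), 𝕜)) :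
    (fun t : Icc a b => φ ⟨g t, map_mem_Icc t⟩) ∈ g.BD 𝕜 a b :=
  mem_BD_of_forall_gContWithin (fun _ => φ.norm_coe_le_norm _)
    (gContWithin_comp_continuousMap H φ)

lemma isIntegralSolution_of_isFixedPt (H : g.Admissible a b) {β : Icc a b → 𝕜}
    (hβ : β ∈ g.BD 𝕜 a b) {φ : C(Icc (g a) (g b), 𝕜)}
    (hφ : Function.IsFixedPt (volterra H hβ).next φ) :
    IsIntegralSolution H β (fun t : Icc a b => φ ⟨g t, map_mem_Icc t⟩) := by
  have hI := integrable_of_mem_BD H (mul_mem_BD hβ (comp_continuousMap_mem_BD H φ))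
  have heq : ∀ r, φ r = 1 + ∫ s in (g a)..r, (volterra H hβ).integrand φ s := fun r => by
    rw [← DelayVolterra.next_apply, hφ]
  refine ⟨?_, hI, fun x y hxy => ?_⟩
  · rw [heq]
    simp [Admissible.start]
  · have hint := (volterra H hβ).intervalIntegrable_integrand φ
    have hsub : ∀ t : Icc a b, IntervalIntegrable ((volterra H hβ).integrand φ) volume (g a) (g t) :=
      fun t => hint.mono_set (uIcc_subset_uIcc left_mem_uIcc (map_mem_uIcc H t))
    rw [setIntegral_Ico_eq H hI.aestronglyMeasurable hxy]
    simp only [← volterra_integrand H hβ]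
    rw [heq, heq, add_sub_add_left_eq_sub,
      intervalIntegral.integral_interval_sub_left (hsub y) (hsub x)]

/-- A solution v prescribes φ only on the range of g; the integral extends it continuously over the
gaps. -/
lemma IsIntegralSolution.exists_isFixedPt (H : g.Admissible a b) {β : Icc a b → 𝕜}
    (hβ : β ∈ g.BD 𝕜 a b) {v : Icc a b → 𝕜} (hv : IsIntegralSolution H β v) :
    ∃ φ : C(Icc (g a) (g b), 𝕜), Function.IsFixedPt (volterra H hβ).next φ ∧
      v = fun t : Icc a b => φ ⟨g t, map_mem_Icc t⟩ := by
  have hint := intervalIntegrable_comp_quantile H hv.integrable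
  have hcont := intervalIntegral.continuousOn_primitive_interval' hint left_mem_uIcc
  rw [uIcc_of_le (g.mono H.lt.le), continuousOn_iff_continuous_domRestrict] at hcont
  let φ : C(Icc (g a) (g b), 𝕜) :=
    ⟨fun r => 1 + ∫ s in (g a)..r, (β * v) (quantile H s), continuous_const.add hcont⟩
  have hφ : v = fun t : Icc a b => φ ⟨g t, map_mem_Icc t⟩ := by
    ext t
    have := sub_eq_intervalIntegral H hv.integrable.aestronglyMeasurable hv.sub_eq H.start t
    rw [hv.start, sub_eq_iff_eq_add'] at this
    exact this
  refine ⟨φ, ?_, hφ⟩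
  ext r
  rw [DelayVolterra.next_apply]
  simp only [volterra_integrand, ← hφ]
  rfl

theorem existsUnique_isIntegralSolution (H : g.Admissible a b) {β : Icc a b → 𝕜}
    (hβ : β ∈ g.BD 𝕜 a b) : ∃! v : Icc a b → 𝕜, IsIntegralSolution H β v := by
  obtain ⟨φ, hφ, huniq⟩ := (volterra H hβ).existsUnique_fixedPoint
  refine ⟨_, isIntegralSolution_of_isFixedPt H hβ hφ, fun v hv => ?_⟩
  obtain ⟨ψ, hψ, rfl⟩ := hv.exists_isFixedPt H hβ
  rw [huniq ψ hψ]

namespace IsIntegralSolution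

variable {H : g.Admissible a b} {β v : Icc a b → 𝕜}

lemma gContWithin (hβ : β ∈ g.BD 𝕜 a b) (hv : IsIntegralSolution H β v) (t : Icc a b) :
    g.GContWithin v univ t := by
  obtain ⟨φ, -, rfl⟩ := hv.exists_isFixedPt H hβ
  exact gContWithin_comp_continuousMap H φ t

lemma mem_BD (hβ : β ∈ g.BD 𝕜 a b) (hv : IsIntegralSolution H β v) : v ∈ g.BD 𝕜 a b := by
  obtain ⟨φ, -, rfl⟩ := hv.exists_isFixedPt H hβ
  exact comp_continuousMap_mem_BD H φ

lemma hasGDerivAt (hβ : β ∈ g.BD 𝕜 a b) (hv : IsIntegralSolution H β v) {t : Icc a b}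
    (ht : (t : ℝ) ∉ g.C) : g.HasGDerivAt v (β t * v t) t :=
  hasGDerivAt_of_mem_BD H (mul_mem_BD hβ (hv.mem_BD hβ)) hv.sub_eq ht

lemma mem_BD1 (hβ : β ∈ g.BD 𝕜 a b) (hv : IsIntegralSolution H β v) : v ∈ BD1 𝕜 H :=
  mem_BD1_of_hasGDerivAt H (hv.mem_BD hβ) (mul_mem_BD hβ (hv.mem_BD hβ))
    fun _ ht => hv.hasGDerivAt hβ ht

end IsIntegralSolution

lemma ae_measureOn_iff {p : Icc a b → Prop} :
    (∀ᵐ t : Icc a b ∂(g.measureOn a b), (t : ℝ) < b → p t) ↔ ∀ᵐ t ∂(g.measureIco a b), p t := by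
  rw [measureIco, ae_restrict_iff' (measurableSet_lt measurable_subtype_coe measurable_const)]
  rfl

lemma solvesAE_of_hasGDerivAt (H : g.Admissible a b) {β w : Icc a b → 𝕜}
    (h : ∀ t : Icc a b, (t : ℝ) ∉ g.C → g.HasGDerivAt w (β t * w t) t) : g.SolvesAE β w :=
  ae_measureOn_iff.2 ((ae_notMem_C H).mono h)

/-- By Lebesgue differentiation the density of v is its `g`-derivative almost everywhere, hence
equals βv by uniqueness of the derivative. -/
theorem isW11Solution_iff (H : g.Admissible a b) {β v : Icc a b → 𝕜} (hβ : β ∈ g.BD 𝕜 a b) :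
    IsW11Solution H β v ↔ IsIntegralSolution H β v := by
  constructor
  · rintro ⟨⟨-, u, hu, hsub⟩, hsolves, hstart⟩
    have hd := ae_hasGDerivAt_of_integral H hu hsub
    have he : u =ᵐ[g.measureIco a b] β * v := by
      filter_upwards [hd, ae_measureOn_iff.1 hsolves] with t h1 h2
      exact h1.unique H h2
    refine ⟨hstart, Integrable.congr hu he, fun x y hxy => ?_⟩
    rw [hsub x y hxy, ← measureIco_restrict_Ico]
    exact integral_congr_ae (ae_restrict_of_ae he)
  · intro hv
    exact ⟨⟨integrable_of_mem_BD H (hv.mem_BD hβ), β * v, hv.integrable, hv.sub_eq⟩,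
      solvesAE_of_hasGDerivAt H fun t ht => hv.hasGDerivAt hβ ht, hv.start⟩

/-- A `BD¹_g`-function which solves the linear equation `g`-almost everywhere solves it at every
point off `C_g`. -/
lemma SolvesAE.hasGDerivAt (H : g.Admissible a b) {β w : Icc a b → 𝕜} (hβ : β ∈ g.BD 𝕜 a b)
    (hw : w ∈ BD1 𝕜 H) (h : g.SolvesAE β w) {t : Icc a b} (ht : (t : ℝ) ∉ g.C) :
    g.HasGDerivAt w (β t * w t) t := by
  obtain ⟨hwBD, w', hw', hd⟩ := hw
  have he : ∀ᵐ t ∂(g.measureIco a b), w' t = (β * w) t := by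
    filter_upwards [ae_measureOn_iff.1 h] with t h2
    exact (hd t).unique H h2
  have := eq_of_ae_eq H hw' (mul_mem_BD hβ hwBD) he ht
  rw [Pi.mul_apply] at this
  exact this ▸ hd t

/-! ### The solution v does not vanish and has a bounded inverse. -/

namespace IsIntegralSolution

variable {H : g.Admissible a b} {β v : Icc a b → 𝕜}

lemma tendsto_nhdsLE (hβ : β ∈ g.BD 𝕜 a b) (hv : IsIntegralSolution H β v) (t : Icc a b) :
    Tendsto v (𝓝[≤] t) (𝓝 (v t)) := by
  have h1 := gContWithin_iff_tendsto.1 (hv.gContWithin hβ t)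
  rw [principal_univ, inf_top_eq] at h1
  exact h1.mono_left (tendsto_iff_comap.1
    ((Derivator.tendsto_nhdsLE (g := g) t).comp (tendsto_coe_nhdsLE t)))

lemma tendsto_nhdsGT (hv : IsIntegralSolution H β v) {t : Icc a b} (ht : (t : ℝ) < b) :
    Tendsto v (𝓝[>] t) (𝓝 (v t * (1 + β t * g.jump t))) := by
  have := tendsto_nhdsGT_of_integral H hv.integrable hv.sub_eq ht
  convert this using 2
  rw [Pi.mul_apply]
  ring

lemma one_add_mul_jump_ne_zero (hreg : g.IsRegressive β) (t : Icc a b) :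
    1 + β t * (g.jump t : 𝕜) ≠ 0 := by
  by_cases hD : (t : ℝ) ∈ g.D
  · exact hreg t hD
  · simp [jump_eq_zero hD]

/-- A solution which vanishes at a point other than `a` vanishes at some point on its left. -/
lemma exists_lt_eq_zero (hβ : β ∈ g.BD 𝕜 a b) (hv : IsIntegralSolution H β v) {t : Icc a b}
    (ht : a < t) (h0 : v t = 0) : ∃ s < t, v s = 0 := by
  obtain ⟨M, hM⟩ := hβ.1
  obtain ⟨M', hM'⟩ := (hv.mem_BD hβ).1
  have hM0 : 0 ≤ M := (norm_nonneg _).trans (hM t)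
  have hlim : Tendsto (fun s => M * (g t - g s)) (𝓝[<] (t : ℝ)) (𝓝 0) := by
    have := ((Derivator.tendsto_nhdsLE (g := g) t).mono_left
      (nhdsWithin_mono _ Iio_subset_Iic_self)).const_sub (g t) |>.const_mul M
    simpa using this
  -- Left-continuity of g at t makes M(g(t) - g(s)) < 1/2 available, so integrating backwards from
  -- the zero at t contracts the supremum k of ‖v‖ on [s, t].
  obtain ⟨s, hs, hst⟩ := ((hlim.eventually_lt_const (half_pos one_pos)).and
    (Ioo_mem_nhdsLT ht)).exists
  let s' : Icc a b := ⟨s, hst.1.le, hst.2.le.trans t.2.2⟩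
  have hbdd : BddAbove ((fun r => ‖v r‖) '' Icc s' t) := ⟨M', by rintro _ ⟨r, -, rfl⟩; exact hM' r⟩
  have hne : ((fun r => ‖v r‖) '' Icc s' t).Nonempty := ⟨_, t, ⟨hst.2.le, le_rfl⟩, rfl⟩
  set k := sSup ((fun r => ‖v r‖) '' Icc s' t) with hk
  have hle : ∀ r ∈ Icc s' t, ‖v r‖ ≤ k := fun r hr => le_csSup hbdd ⟨r, hr, rfl⟩
  have hk0 : 0 ≤ k := (norm_nonneg _).trans (hle t ⟨hst.2.le, le_rfl⟩)
  have hhalf : k ≤ 1 / 2 * k := by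
    refine csSup_le hne ?_
    rintro _ ⟨r, hr, rfl⟩
    have hvr : v r = -∫ x in Ico r t, (β * v) x ∂(g.measureOn a b) := by
      rw [← hv.sub_eq r t hr.2, h0, zero_sub, neg_neg]
    have hfin : g.measureOn a b (Ico r t) < ⊤ := by
      rw [measureOn_Ico]
      exact ENNReal.ofReal_lt_top
    have hreal : (g.measureOn a b).real (Ico r t) = g t - g r := by
      rw [measureReal_def, measureOn_Ico, ENNReal.toReal_ofReal (sub_nonneg.2 (g.mono hr.2))]
    have hnorm := norm_setIntegral_le_of_norm_le_const (f := β * v) (C := M * k) hfin fun x hx => by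
      rw [Pi.mul_apply, norm_mul]
      exact mul_le_mul (hM x) (hle x ⟨hr.1.trans hx.1, hx.2.le⟩) (norm_nonneg _) hM0
    rw [hreal] at hnorm
    simp only
    rw [hvr, norm_neg]
    have hgr : M * (g t - g r) ≤ M * (g t - g s) :=
      mul_le_mul_of_nonneg_left (sub_le_sub_left (g.mono hr.1) _) hM0
    calc _ ≤ M * k * (g t - g r) := hnorm
      _ = M * (g t - g r) * k := by ring
      _ ≤ 1 / 2 * k := mul_le_mul_of_nonneg_right (hgr.trans hs.le) hk0
  have hs0 := hle s' ⟨le_rfl, hst.2.le⟩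
  exact ⟨s', hst.2, norm_le_zero_iff.1 (by linarith)⟩

/-- Let x be the infimum of the zeros. If v(x) ≠ 0, the right limit v(x)(1 + β(x)Δg(x)) is nonzero
and no zeros accumulate at x from the right. So v(x) = 0, hence x is not the left endpoint, and
`exists_lt_eq_zero` gives an earlier zero. -/
lemma ne_zero (hβ : β ∈ g.BD 𝕜 a b) (hreg : g.IsRegressive β) (hv : IsIntegralSolution H β v)
    (t : Icc a b) : v t ≠ 0 := by
  intro ht
  set Z : Set ℝ := (fun s : Icc a b => (s : ℝ)) '' {s | v s = 0} with hZ
  have hne : Z.Nonempty := ⟨t, t, ht, rfl⟩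
  have hbd : BddBelow Z := ⟨a, by rintro _ ⟨s, -, rfl⟩; exact s.2.1⟩
  have hle : sInf Z ≤ t := csInf_le hbd ⟨t, ht, rfl⟩
  let x : Icc a b := ⟨sInf Z, le_csInf hne (by rintro _ ⟨s, -, rfl⟩; exact s.2.1), hle.trans t.2.2⟩
  have hmin : ∀ s, v s = 0 → x ≤ s := fun s hs => csInf_le hbd ⟨s, hs, rfl⟩
  have hx0 : v x = 0 := by
    by_contra hx
    have hxt : x < t := lt_of_le_of_ne hle fun h => hx (h ▸ ht)
    have hlim := hv.tendsto_nhdsGT (lt_of_lt_of_le (Subtype.coe_lt_coe.2 hxt) t.2.2)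
    have hev := hlim.eventually_ne (mul_ne_zero hx (one_add_mul_jump_ne_zero hreg x))
    obtain ⟨u, hu, hsub⟩ := (mem_nhdsGT_iff_exists_Ioo_subset' hxt).1 hev
    have hu' : sInf Z < (u : ℝ) := hu
    obtain ⟨_, ⟨z, hz, rfl⟩, hzu⟩ := exists_lt_of_csInf_lt hne hu'
    exact hsub ⟨lt_of_le_of_ne (hmin z hz) fun h => hx (h ▸ hz), hzu⟩ hz
  have hxa : a < x := lt_of_le_of_ne x.2.1 fun h => by
    have : x = H.start := Subtype.ext h.symm
    rw [this, hv.start] at hx0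
    exact one_ne_zero hx0
  obtain ⟨s, hs, hs0⟩ := hv.exists_lt_eq_zero hβ hxa hx0
  exact absurd (hmin s hs0) (not_le.2 hs)

/-- Since v may jump, the bound comes from its nonzero one-sided limits, which make 1/v locally
bounded, and from compactness. -/
lemma exists_norm_inv_le (hβ : β ∈ g.BD 𝕜 a b) (hreg : g.IsRegressive β)
    (hv : IsIntegralSolution H β v) : ∃ K, ∀ t, ‖v⁻¹ t‖ ≤ K := by
  have key : ∃ K, ∀ t ∈ (univ : Set (Icc a b)), ‖v⁻¹ t‖ ≤ K := by
    refine isCompact_univ.induction_on (p := fun S => ∃ K, ∀ t ∈ S, ‖v⁻¹ t‖ ≤ K) ⟨0, by simp⟩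
      (fun S S' h ⟨K, hK⟩ => ⟨K, fun t ht => hK t (h ht)⟩) ?_ fun t _ => ?_
    · rintro S S' ⟨K, hK⟩ ⟨K', hK'⟩
      exact ⟨max K K', fun t ht => ht.elim (fun h => (hK t h).trans (le_max_left _ _))
        fun h => (hK' t h).trans (le_max_right _ _)⟩
    · have hl := ((hv.tendsto_nhdsLE hβ t).inv₀ (hv.ne_zero hβ hreg t)).norm.eventually_lt_const
        (lt_add_one _)
      have hr : ∃ K, ∀ᶠ s in 𝓝[>] t, ‖v⁻¹ s‖ ≤ K := by
        rcases t.2.2.lt_or_eq with htb | htb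
        · exact ⟨_, (((hv.tendsto_nhdsGT htb).inv₀ (mul_ne_zero (hv.ne_zero hβ hreg t)
            (one_add_mul_jump_ne_zero hreg t))).norm.eventually_lt_const
            (lt_add_one _)).mono fun _ h => le_of_lt h⟩
        · refine ⟨0, eventually_nhdsWithin_of_forall fun s hs => absurd s.2.2 (not_le.2 ?_)⟩
          exact lt_of_eq_of_lt htb.symm hs
      obtain ⟨K, hr⟩ := hr
      refine ⟨{s | ‖v⁻¹ s‖ ≤ max (‖(v t)⁻¹‖ + 1) K}, ?_, _, fun s hs => hs⟩
      rw [nhdsWithin_univ, ← nhdsLE_sup_nhdsGT]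
      exact ⟨hl.mono fun s hs => (le_of_lt hs).trans (le_max_left _ _),
        hr.mono fun s hs => hs.trans (le_max_right _ _)⟩
  obtain ⟨K, hK⟩ := key
  exact ⟨K, fun t => hK t (mem_univ t)⟩

lemma inv_mem_BD (hβ : β ∈ g.BD 𝕜 a b) (hreg : g.IsRegressive β)
    (hv : IsIntegralSolution H β v) : v⁻¹ ∈ g.BD 𝕜 a b := by
  obtain ⟨K, hK⟩ := hv.exists_norm_inv_le hβ hreg
  exact mem_BD_of_forall_gContWithin hK fun t =>
    (hv.gContWithin hβ t).inv (hv.ne_zero hβ hreg t)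

end IsIntegralSolution

/-! ### The space of solutions as a copy of `ker ∂_g`. -/

lemma mem_solutionSpace_iff (H : g.Admissible a b) {β w : Icc a b → 𝕜} (hβ : β ∈ g.BD 𝕜 a b) :
    w ∈ solutionSpace H β ↔ w ∈ BD1 𝕜 H ∧
      ∀ t : Icc a b, (t : ℝ) ∉ g.C → g.HasGDerivAt w (β t * w t) t :=
  ⟨fun h => ⟨h.1, fun _ ht => SolvesAE.hasGDerivAt H hβ h.1 h.2 ht⟩,
    fun h => ⟨h.1, solvesAE_of_hasGDerivAt H h.2⟩⟩

namespace IsIntegralSolution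

variable {H : g.Admissible a b} {β v : Icc a b → 𝕜}

lemma mul_mem_solutionSpace (hβ : β ∈ g.BD 𝕜 a b) (hv : IsIntegralSolution H β v)
    {h : BD1 𝕜 H} (hh : h ∈ LinearMap.ker (gDeriv 𝕜 H)) :
    (h : Icc a b → 𝕜) * v ∈ solutionSpace H β := by
  have hd : ∀ t : Icc a b, (t : ℝ) ∉ g.C →
      g.HasGDerivAt ((h : Icc a b → 𝕜) * v) ((β * ((h : Icc a b → 𝕜) * v)) t) t := fun t ht => by
    have := ((mem_ker_gDeriv_iff H h).1 hh t ht).mul_of_zero ht (hv.hasGDerivAt hβ ht)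
    rwa [mul_left_comm] at this
  have hBD := mul_mem_BD h.2.1 (hv.mem_BD hβ)
  exact (mem_solutionSpace_iff H hβ).2
    ⟨mem_BD1_of_hasGDerivAt H hBD (mul_mem_BD hβ hBD) hd, hd⟩

lemma hasGDerivAt_div (hβ : β ∈ g.BD 𝕜 a b) (hreg : g.IsRegressive β)
    (hv : IsIntegralSolution H β v) {w : Icc a b → 𝕜} {t : Icc a b} (ht : (t : ℝ) ∉ g.C)
    (hw : g.HasGDerivAt w (β t * w t) t) : g.HasGDerivAt (w / v) 0 t :=
  hw.div_of_proportional ht (hv.hasGDerivAt hβ ht) (hv.ne_zero hβ hreg t)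
    (one_add_mul_jump_ne_zero hreg t)

lemma div_mem_BD1 (hβ : β ∈ g.BD 𝕜 a b) (hreg : g.IsRegressive β)
    (hv : IsIntegralSolution H β v) {w : Icc a b → 𝕜} (hw : w ∈ solutionSpace H β) :
    w / v ∈ BD1 𝕜 H := by
  rw [mem_solutionSpace_iff H hβ] at hw
  refine mem_BD1_of_hasGDerivAt H ?_ (zero_mem _) fun t ht =>
    hv.hasGDerivAt_div hβ hreg ht (hw.2 t ht)
  rw [div_eq_mul_inv]
  exact mul_mem_BD hw.1.1 (hv.inv_mem_BD hβ hreg)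

/-- Multiplication by the nonvanishing solution `v` identifies `ker ∂_g` with the space of
solutions. -/
def kerEquiv (hβ : β ∈ g.BD 𝕜 a b) (hreg : g.IsRegressive β) (hv : IsIntegralSolution H β v) :
    LinearMap.ker (gDeriv 𝕜 H) ≃ₗ[𝕜] solutionSpace H β where
  toFun h := ⟨((h : BD1 𝕜 H) : Icc a b → 𝕜) * v, hv.mul_mem_solutionSpace hβ h.2⟩
  map_add' h₁ h₂ := Subtype.ext (add_mul _ _ _)
  map_smul' c h := Subtype.ext (smul_mul_assoc _ _ _)
  invFun w := ⟨⟨(w : Icc a b → 𝕜) / v, hv.div_mem_BD1 hβ hreg w.2⟩,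
    (mem_ker_gDeriv_iff H _).2 fun t ht =>
      hv.hasGDerivAt_div hβ hreg ht (((mem_solutionSpace_iff H hβ).1 w.2).2 t ht)⟩
  left_inv h := by
    ext t
    exact mul_div_cancel_right₀ _ (hv.ne_zero hβ hreg t)
  right_inv w := by
    ext t
    exact div_mul_cancel₀ _ (hv.ne_zero hβ hreg t)

lemma mem_ker_iff (hβ : β ∈ g.BD 𝕜 a b) (hreg : g.IsRegressive β)
    (hv : IsIntegralSolution H β v) (h : BD1 𝕜 H) (h1 : (h : Icc a b → 𝕜) H.start = 1) :
    h ∈ LinearMap.ker (gDeriv 𝕜 H) ↔ IsBDSolution H β ((h : Icc a b → 𝕜) * v) ∧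
      ∀ t : Icc a b, (t : ℝ) ∉ g.C →
        g.HasGDerivAt ((h : Icc a b → 𝕜) * v) (β t * ((h : Icc a b → 𝕜) * v) t) t := by
  constructor
  · intro hh
    have hs := hv.mul_mem_solutionSpace hβ hh
    refine ⟨⟨hs.1, hs.2, ?_⟩, ((mem_solutionSpace_iff H hβ).1 hs).2⟩
    rw [Pi.mul_apply, h1, hv.start, one_mul]
  · rintro ⟨-, hd⟩
    refine (mem_ker_gDeriv_iff H h).2 fun t ht => ?_
    have e : (h : Icc a b → 𝕜) * v / v = h := by
      ext s
      exact mul_div_cancel_right₀ _ (hv.ne_zero hβ hreg s)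
    have := hv.hasGDerivAt_div hβ hreg ht (hd t ht)
    rwa [e] at this

lemma isBDSolution (hβ : β ∈ g.BD 𝕜 a b) (hv : IsIntegralSolution H β v) : IsBDSolution H β v :=
  ⟨hv.mem_BD1 hβ, solvesAE_of_hasGDerivAt H fun _ ht => hv.hasGDerivAt hβ ht, hv.start⟩

end IsIntegralSolution

/-! ### The affine hyperplane w(0) = 1. -/

/-- Let `v` be an element of a subspace `P` on which the functional `e` takes the value `1`.
The span of the affine hyperplane `e = 1` of `P` is `P`, and its direction has codimension one. -/
lemma span_and_rank_vectorSpan.{u} {K V : Type u} [Field K] [AddCommGroup V] [Module K V]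
    (P : Submodule K V) (e : V →ₗ[K] K) {v : V} (hv : v ∈ P) (hev : e v = 1) :
    Submodule.span K {w | w ∈ P ∧ e w = 1} = P ∧
      Module.rank K (vectorSpan K {w | w ∈ P ∧ e w = 1}) + 1 = Module.rank K P := by
  have hmem : v ∈ {w | w ∈ P ∧ e w = 1} := ⟨hv, hev⟩
  have hvec : vectorSpan K {w | w ∈ P ∧ e w = 1} = P ⊓ LinearMap.ker e := by
    apply le_antisymm
    · rw [vectorSpan_def, Submodule.span_le]
      rintro _ ⟨x, hx, y, hy, rfl⟩
      refine ⟨P.sub_mem hx.1 hy.1, ?_⟩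
      change e (x - y) = 0
      rw [map_sub, hx.2, hy.2, sub_self]
    · rintro w ⟨hw, hew⟩
      have hw' : w + v ∈ {w | w ∈ P ∧ e w = 1} := ⟨P.add_mem hw hv, by
        rw [map_add, hev, LinearMap.mem_ker.1 hew, zero_add]⟩
      have := vsub_mem_vectorSpan K hw' hmem
      rwa [vsub_eq_sub, add_sub_cancel_right] at this
  refine ⟨le_antisymm (Submodule.span_le.2 fun w hw => hw.1) fun w hw => ?_, ?_⟩
  -- Moving w along v to the level e = 1 writes it as a combination of two points of the hyperplane.
  · have h1 : w - e w • v + v ∈ {w | w ∈ P ∧ e w = 1} :=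
      ⟨P.add_mem (P.sub_mem hw (P.smul_mem _ hv)) hv, by simp [hev]⟩
    have h2 : w = (w - e w • v + v) + (e w - 1) • v := by
      rw [sub_smul, one_smul]
      abel
    rw [h2]
    exact add_mem (Submodule.subset_span h1) (Submodule.smul_mem _ _ (Submodule.subset_span hmem))
  · have hsurj : Function.Surjective (e.domRestrict P) := fun c =>
      ⟨c • ⟨v, hv⟩, by simp [hev]⟩
    have hker : Module.rank K (LinearMap.ker (e.domRestrict P)) =
        Module.rank K (P ⊓ LinearMap.ker e : Submodule K V) := by
      have h1 : (LinearMap.ker (e.domRestrict P)).map P.subtype = P ⊓ LinearMap.ker e := by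
        rw [← Submodule.map_comap_subtype]
        rfl
      rw [← h1]
      exact (Submodule.equivMapOfInjective _ P.injective_subtype _).rank_eq
    have hrank := LinearMap.rank_range_add_rank_ker (e.domRestrict P)
    rw [LinearMap.range_eq_top.2 hsurj, rank_top, hker] at hrank
    rw [hvec, add_comm, ← hrank, Module.rank_self]

end Derivator

end

theorem mainTheorem12 {𝕜 : Type*} [RCLike 𝕜] (g : Derivator) (T : ℝ)
    (H : g.Admissible 0 T) (β : Set.Icc 0 T → 𝕜) (hβ : β ∈ g.BD 𝕜 0 T)
    (hreg : g.IsRegressive β) :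
    (∃! v : Set.Icc 0 T → 𝕜, Derivator.IsW11Solution H β v) ∧
    (∀ v : Set.Icc 0 T → 𝕜, Derivator.IsW11Solution H β v →
      v ∈ Derivator.BD1 𝕜 H ∧
      ∀ h : Derivator.BD1 𝕜 H, (h : Set.Icc 0 T → 𝕜) H.start = 1 →
        (h ∈ LinearMap.ker (Derivator.gDeriv 𝕜 H) ↔
          Derivator.IsBDSolution H β ((h : Set.Icc 0 T → 𝕜) * v) ∧
          ∀ t : Set.Icc 0 T, (t : ℝ) ∉ g.C →
            g.HasGDerivAt ((h : Set.Icc 0 T → 𝕜) * v)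
              (β t * ((h : Set.Icc 0 T → 𝕜) * v) t) t)) ∧
    Module.rank 𝕜 (Derivator.solutionSpace H β) =
      Module.rank 𝕜 (LinearMap.ker (Derivator.gDeriv 𝕜 H)) ∧
    Submodule.span 𝕜 {w : Set.Icc 0 T → 𝕜 | Derivator.IsBDSolution H β w} =
      Derivator.solutionSpace H β ∧
    Module.rank 𝕜 (vectorSpan 𝕜 {w : Set.Icc 0 T → 𝕜 | Derivator.IsBDSolution H β w}) + 1 =
      Module.rank 𝕜 (LinearMap.ker (Derivator.gDeriv 𝕜 H)) := by
  obtain ⟨v, hv, huniq⟩ := Derivator.existsUnique_isIntegralSolution H hβ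
  have hrank := (hv.kerEquiv hβ hreg).rank_eq
  -- The initial condition is the value 1 of the evaluation functional at 0.
  have hS : {w : Set.Icc 0 T → 𝕜 | Derivator.IsBDSolution H β w} =
      {w | w ∈ Derivator.solutionSpace H β ∧ LinearMap.proj (R := 𝕜) H.start w = (1 : 𝕜)} :=
    Set.ext fun w => and_assoc.symm
  have hvS := hv.isBDSolution hβ
  have hlin := Derivator.span_and_rank_vectorSpan (Derivator.solutionSpace H β)
    (LinearMap.proj (R := 𝕜) H.start) (v := v) ⟨hvS.1, hvS.2.1⟩ hvS.2.2
  rw [hS]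
  refine ⟨⟨v, (Derivator.isW11Solution_iff H hβ).2 hv, fun w hw =>
    huniq w ((Derivator.isW11Solution_iff H hβ).1 hw)⟩, fun w hw => ?_, hrank.symm, hlin.1,
    hlin.2.trans hrank.symm⟩
  have hw := (Derivator.isW11Solution_iff H hβ).1 hw
  exact ⟨hw.mem_BD1 hβ, fun h h1 => hw.mem_ker_iff hβ hreg h h1⟩
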